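/- **Setting.** Inner products are linear in the first variable. Let $X$ be a countable set, $w:X\to\mathbb C$ a function, and $\varphi:X\to X$ a map with one orbit, i.e. for all $x,y\in X$ there are $i,j\ge 0$ with $\varphi^{(i)}(x)=\varphi^{(j)}(y)$, where $\varphi^{(n)}$ is the $n$-th iterate of $\varphi$. A point $x$ lies in a cycle if $\varphi^{(i)}(x)=x$ for some $i\ge1$. Let $[\varphi]:X\to\mathbb Z$ be the function that is $0$ on the cycle of $\varphi$ (if $\varphi$ has one), satisfies $[\varphi](\varphi(x))=[\varphi](x)-1$ for $x$ not in a cycle, and, if $\varphi$ has no cycle, satisfies $[\varphi](x^*)=0$ for a fixed base point $x^*$. Assume that $\varphi$ has finite branching index: $\sup\{|[\varphi](x)| : \operatorname{card}\varphi^{-1}(x)\ge 2\}<\infty$. If $\varphi$ has no cycle, let $\Omega\in X$ be a generalized root: $\operatorname{card}\varphi^{-1}(\varphi^{(n)}(\Omega))=1$ for all $n\ge 1$, and $\operatorname{card}\varphi^{-1}(\Omega)\ge 2$ whenever some point of $X$ has at least two preimages; in this case take $x^*=\varphi(\Omega)$. Let $T=C_{\varphi,w}$, $C_{\varphi,w}f=w\cdot(f\circ\varphi)$,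 be bounded on $\ell^2(X)$ and left-invertible, with Cauchy dual $T'=T(T^*T)^{-1}$. Let $(e_x)_{x\in X}$ be the standard basis of $\ell^2(X)$, $\operatorname{Des}(x)=\bigcup_{n\ge0}\varphi^{(-n)}(x)$, where $\varphi^{(-n)}(x)=\{y\in X:\varphi^{(n)}(y)=x\}$, let $\mathcal N$ denote the kernel, and let $$E=\begin{cases}\text{the closed linear span of } e_x \text{ and } \mathcal N\big((C_{\varphi,w}|_{\ell^2(\operatorname{Des}(x))})^*\big) \text{ over all } x \text{ with } [\varphi](x)=1, & \text{if } \varphi \text{ has a cycle},\\ \langle e_\Omega\rangle\oplus\mathcal N(C_{\varphi,w}^*), & \text{otherwise.}\end{cases}$$ Let $P_E$ be the orthogonal projection onto $E$, and let $[E]_{A,B}$ be the closed linear span of $\{A^nx,\,B^nx : x\in E,\ n\ge 0\}$. Assume $[E]_{T^*,T'}=\ell^2(X)$ and $[E]_{T'^*,T}=\ell^2(X)$. For $x\in\ell^2(X)$ define the formal Laurent series with coefficients in $E$ $$U_x(z)=\sum_{n\ge1}(P_ET^nx)z^{-n}+\sum_{n\ge0}(P_ET'^{*n}x)z^n,\qquad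 U'_x(z)=\sum_{n\ge1}(P_ET'^nx)z^{-n}+\sum_{n\ge0}(P_ET^{*n}x)z^n .$$ Let $\mathcal H=\{U_x:x\in\ell^2(X)\}$ and $\mathcal H'=\{U'_x:x\in\ell^2(X)\}$; the maps $U:x\mapsto U_x$ and $U':x\mapsto U'_x$ are bijections of $\ell^2(X)$ onto $\mathcal H$ and $\mathcal H'$. Write $\hat f(n)$ for the $n$-th coefficient of a Laurent series $f$, and $\mathbb A(r,R)=\{z\in\mathbb C: r<|z|<R\}$. Let $0\le r^-<r^+\le\infty$ and $0\le r'^-<r'^+\le\infty$ be such that for every $x\in\ell^2(X)$ the series $U_x$ converges in $E$ at every point of $\mathbb A(r^-,r^+)$ and $U'_x$ converges in $E$ at every point of $\mathbb A(r'^-,r'^+)$. Thus the elements of $\mathcal H$ are $E$-valued holomorphic functions on $\mathbb A(r^-,r^+)$, and $\mathcal H\cap\mathrm{Hol}(\mathbb A(r^-,\infty),E)$ denotes the set of those which have a holomorphic extension to $\mathbb A(r^-,\infty)$. **Theorem 7.3.** Suppose in addition that $r^-<1$ and $r'^-\le1\le r'^+$. Then the duality between $\mathcal H$ and $\mathcal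 H'$ obtained by identifying them with $\ell^2(X)$ is the same as the duality obtained from the Cauchy pairing: for all $f\in\mathcal H\cap\mathrm{Hol}(\mathbb A(r^-,\infty),E)$ and all $g\in\mathcal H'$ the series below converges (absolutely) and $$\langle U^{-1}f,\,U'^{-1}g\rangle_{\ell^2(X)}=\sum_{n=-\infty}^{\infty}\langle\hat f(n),\hat g(n)\rangle_E .$$ -/

import Mathlib

open Filter Topology Function
open scoped ENNReal InnerProduct

noncomputable section

/-! ## Self-maps of a countable set -/

/-- `φ` has one orbit: any two points have a common iterated image. -/
def SingleOrbit {X : Type*} (φ : X → X) : Prop :=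
  ∀ x y : X, ∃ i j : ℕ, φ^[i] x = φ^[j] y

/-- `φ` has a cycle. The union of the cycles is `Function.periodicPts φ`. -/
def HasCycle {X : Type*} (φ : X → X) : Prop :=
  (periodicPts φ).Nonempty

open Classical in
/-- The function `[φ] : X → ℤ` with base point `xs`. For a point whose orbit contains a cycle it is
the number of steps needed to reach the cycle; for a point `x` of a cycle-free orbit containing
`xs` it is `i - j` for any `i, j` with `φ^[i] x = φ^[j] xs`. The next three lemmas
are the three properties that define `[φ]` (for a map with one orbit). -/
def generation {X : Type*} (φ : X → X) (xs x : X) : ℤ :=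
  if h : ∃ n : ℕ, φ^[n] x ∈ periodicPts φ then (Nat.find h : ℤ)
  else if h : ∃ p : ℕ × ℕ, φ^[p.1] x = φ^[p.2] xs then (h.choose.1 : ℤ) - h.choose.2
  else 0

theorem generation_of_mem_periodicPts {X : Type*} (φ : X → X) (xs x : X)
    (hx : x ∈ periodicPts φ) : generation φ xs x = 0 := by
  classical
  have h : ∃ n : ℕ, φ^[n] x ∈ periodicPts φ := ⟨0, hx⟩
  simp only [generation, dif_pos h]
  exact_mod_cast (Nat.find_eq_zero h).2 hx

theorem iterate_injective_of_not_reach {X : Type*} (φ : X → X) (x : X)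
    (h : ¬ ∃ n : ℕ, φ^[n] x ∈ periodicPts φ) {m n : ℕ} (hmn : φ^[m] x = φ^[n] x) : m = n := by
  by_contra hne
  wlog hlt : m < n generalizing m n
  · exact this hmn.symm (Ne.symm hne) (by omega)
  refine h ⟨m, mk_mem_periodicPts (n := n - m) (by omega) ?_⟩
  rw [IsPeriodicPt, IsFixedPt, ← iterate_add_apply, Nat.sub_add_cancel hlt.le, hmn]

theorem generation_eq_sub {X : Type*} (φ : X → X) (xs x : X)
    (h : ¬ ∃ n : ℕ, φ^[n] x ∈ periodicPts φ) {i j : ℕ} (hij : φ^[i] x = φ^[j] xs) :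
    generation φ xs x = (i : ℤ) - j := by
  have h2 : ∃ p : ℕ × ℕ, φ^[p.1] x = φ^[p.2] xs := ⟨(i, j), hij⟩
  simp only [generation, dif_neg h, dif_pos h2]
  have hs := h2.choose_spec
  set a := h2.choose.1
  set b := h2.choose.2
  have e : φ^[i + b] x = φ^[a + j] x := by
    rw [add_comm i b, add_comm a j, iterate_add_apply, iterate_add_apply, hij, hs,
      ← iterate_add_apply, ← iterate_add_apply, add_comm]
  have := iterate_injective_of_not_reach φ x h e
  omega

theorem generation_base {X : Type*} (φ : X → X) (xs : X) (hc : ¬ HasCycle φ) :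
    generation φ xs xs = 0 := by
  have h : ¬ ∃ n : ℕ, φ^[n] xs ∈ periodicPts φ := fun ⟨n, hn⟩ => hc ⟨_, hn⟩
  simpa using generation_eq_sub φ xs xs h (i := 0) (j := 0) rfl

theorem generation_map {X : Type*} (φ : X → X) (hφ : SingleOrbit φ) (xs x : X)
    (hx : x ∉ periodicPts φ) : generation φ xs (φ x) = generation φ xs x - 1 := by
  classical
  by_cases h : ∃ n : ℕ, φ^[n] x ∈ periodicPts φ
  · have h1 : ∃ n : ℕ, φ^[n + 1] x ∈ periodicPts φ := by
      obtain ⟨n, hn⟩ := h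
      cases n with
      | zero => exact absurd hn hx
      | succ n => exact ⟨n, hn⟩
    have h2 : ∃ n : ℕ, φ^[n] (φ x) ∈ periodicPts φ := by
      simpa only [iterate_succ_apply] using h1
    have h3 := Nat.find_comp_succ h h1 hx
    have h4 : Nat.find h2 = Nat.find h1 := by
      congr 1
    simp only [generation, dif_pos h, dif_pos h2, h4, h3]
    push_cast
    ring
  · have h2 : ¬ ∃ n : ℕ, φ^[n] (φ x) ∈ periodicPts φ := fun ⟨n, hn⟩ =>
      h ⟨n + 1, by simpa only [iterate_succ_apply] using hn⟩
    obtain ⟨i, j, hij⟩ := hφ (φ x) xs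
    have hij' : φ^[i + 1] x = φ^[j] xs := by simpa only [iterate_succ_apply] using hij
    rw [generation_eq_sub φ xs x h hij', generation_eq_sub φ xs (φ x) h2 hij]
    push_cast
    ring

/-- The points with at least two preimages. -/
def branchingPoints {X : Type*} (φ : X → X) : Set X :=
  {x | 2 ≤ (φ ⁻¹' {x}).encard}

/-- `sup {|[φ](x)| : card (φ⁻¹(x)) ≥ 2} < ∞`. -/
def FiniteBranchingIndex {X : Type*} (φ : X → X) (xs : X) : Prop :=
  BddAbove ((fun x => |generation φ xs x|) '' branchingPoints φ)

/-- Generalized root of the rootless directed tree whose parent map is the cycle-free map `φ`: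
every strict ancestor `φ^[n] Ω`, `n ≥ 1`, has exactly one child, and `Ω` is a branching
vertex whenever the tree has branching vertices. -/
def IsGeneralizedRoot {X : Type*} (φ : X → X) (Ω : X) : Prop :=
  (∀ n : ℕ, 1 ≤ n → (φ ⁻¹' {φ^[n] Ω}).encard = 1) ∧
    ((branchingPoints φ).Nonempty → Ω ∈ branchingPoints φ)

/-- `Des(x)`, the union of the sets `φ^{-n}(x)`, `n ≥ 0`. -/
def descendants {X : Type*} (φ : X → X) (x : X) : Set X :=
  {y | ∃ n : ℕ, φ^[n] y = x}

/-! ## The analytic model of a left-invertible operator -/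

section Model

variable {H : Type*} [NormedAddCommGroup H] [InnerProductSpace ℂ H] [CompleteSpace H]

def IsLeftInvertible (T : H →L[ℂ] H) : Prop :=
  ∃ S : H →L[ℂ] H, S ∘L T = ContinuousLinearMap.id ℂ H

/-- The Cauchy dual `T' = T (T^* T)⁻¹` (`T^* T` is invertible when `T` is left-invertible). -/
def cauchyDual (T : H →L[ℂ] H) : H →L[ℂ] H :=
  T ∘L Ring.inverse (T† ∘L T)

/-- `[E]_{A,B}`: the closed linear span of all `A^n x` and `B^n x`, `x ∈ E`, `n ≥ 0`. -/
def jointSpan (A B : H →L[ℂ] H) (E : Submodule ℂ H) : Submodule ℂ H :=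
  (Submodule.span ℂ ({y | ∃ n : ℕ, ∃ x ∈ E, y = (A ^ n) x} ∪
    {y | ∃ n : ℕ, ∃ x ∈ E, y = (B ^ n) x})).topologicalClosure

/-- The linear map sending `x` to the formal Laurent series
`∑_{n ≥ 1} (P_E A^n x) z^{-n} + ∑_{n ≥ 0} (P_E B^n x) z^n`, a formal Laurent series with
coefficients in `E` being the function `ℤ → E` of its coefficients. -/
def laurentMap (A B : H →L[ℂ] H) (E : Submodule ℂ H) [E.HasOrthogonalProjection] :
    H →ₗ[ℂ] (ℤ → E) :=
  LinearMap.pi fun n : ℤ => match n with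
    | Int.ofNat n => (E.orthogonalProjectionOnto ∘L B ^ n).toLinearMap
    | Int.negSucc n => (E.orthogonalProjectionOnto ∘L A ^ (n + 1)).toLinearMap

theorem laurentMap_injective (A B : H →L[ℂ] H) (E : Submodule ℂ H) [E.HasOrthogonalProjection]
    (h : jointSpan (A†) (B†) E = ⊤) : Injective (laurentMap A B E) := by
  rw [injective_iff_map_eq_zero]
  intro x hx
  have hB : ∀ n : ℕ, E.orthogonalProjectionOnto ((B ^ n) x) = 0 := fun n =>
    congrFun hx (Int.ofNat n)
  have hA : ∀ n : ℕ, E.orthogonalProjectionOnto ((A ^ n) x) = 0 := by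
    intro n
    cases n with
    | zero => simpa using hB 0
    | succ n => exact congrFun hx (Int.negSucc n)
  have key : ∀ C : H →L[ℂ] H, (∀ n : ℕ, E.orthogonalProjectionOnto ((C ^ n) x) = 0) →
      ∀ n : ℕ, ∀ e ∈ E, inner ℂ (((C†) ^ n) e) x = 0 := by
    intro C hC n e he
    have h1 : (C†) ^ n = (C ^ n)† := by
      simp only [← ContinuousLinearMap.star_eq_adjoint, star_pow]
    rw [h1, ContinuousLinearMap.adjoint_inner_left]
    exact (Submodule.orthogonalProjectionOnto_eq_zero_iff.1 (hC n)) e he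
  have hmem : x ∈ (jointSpan (A†) (B†) E)ᗮ := by
    rw [jointSpan, Submodule.orthogonal_closure, Submodule.mem_orthogonal]
    intro u hu
    induction hu using Submodule.span_induction with
    | mem y hy =>
      rcases hy with ⟨n, e, he, rfl⟩ | ⟨n, e, he, rfl⟩
      · exact key A hA n e he
      · exact key B hB n e he
    | zero => simp
    | add a b _ _ ha hb => rw [inner_add_left, ha, hb, add_zero]
    | smul c a _ ha => rw [inner_smul_left, ha, mul_zero]
  rw [h, Submodule.top_orthogonal_eq_bot] at hmem
  exact hmem

/-- The model space `𝓗` of `T`: all formal Laurent series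
`U_x = ∑_{n ≥ 1} (P_E T^n x) z^{-n} + ∑_{n ≥ 0} (P_E T'^{*n} x) z^n`. -/
def modelSpace (T : H →L[ℂ] H) (E : Submodule ℂ H) [E.HasOrthogonalProjection] :
    Submodule ℂ (ℤ → E) :=
  LinearMap.range (laurentMap T ((cauchyDual T)†) E)

/-- The model space `𝓗'` of the Cauchy dual `T'`: all formal Laurent series
`U'_x = ∑_{n ≥ 1} (P_E T'^n x) z^{-n} + ∑_{n ≥ 0} (P_E T^{*n} x) z^n`. -/
def dualModelSpace (T : H →L[ℂ] H) (E : Submodule ℂ H) [E.HasOrthogonalProjection] :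
    Submodule ℂ (ℤ → E) :=
  LinearMap.range (laurentMap (cauchyDual T) (T†) E)

/-- The isomorphism `U` of `H` onto `𝓗`, `U x = U_x`, by which the Hilbert space structure
of `H` is carried over to `𝓗`. -/
def modelEquiv (T : H →L[ℂ] H) (E : Submodule ℂ H) [E.HasOrthogonalProjection]
    (h : jointSpan (T†) (cauchyDual T) E = ⊤) : H ≃ₗ[ℂ] modelSpace T E :=
  LinearEquiv.ofInjective _ (laurentMap_injective T ((cauchyDual T)†) E
    (by rwa [ContinuousLinearMap.adjoint_adjoint]))

/-- The isomorphism `U'` of `H` onto `𝓗'`, `U' x = U'_x`. -/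
def dualModelEquiv (T : H →L[ℂ] H) (E : Submodule ℂ H) [E.HasOrthogonalProjection]
    (h : jointSpan ((cauchyDual T)†) T E = ⊤) : H ≃ₗ[ℂ] dualModelSpace T E :=
  LinearEquiv.ofInjective _ (laurentMap_injective (cauchyDual T) (T†) E
    (by rwa [ContinuousLinearMap.adjoint_adjoint]))

/-- The annulus `{z : r < |z| < R}`; the outer radius may be `∞`. -/
def annulus (r R : ℝ≥0∞) : Set ℂ :=
  {z | r < ‖z‖ₑ ∧ ‖z‖ₑ < R}

/-- The Laurent series with coefficients `f` converges at the point `z` to `s`: its regular and its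
principal part both converge (as limits of partial sums) and the two sums add up to `s`. -/
def LaurentHasSum {F : Type*} [NormedAddCommGroup F] [NormedSpace ℂ F]
    (f : ℤ → F) (z : ℂ) (s : F) : Prop :=
  ∃ p q : F,
    Tendsto (fun N : ℕ => ∑ n ∈ Finset.range N, z ^ n • f (n : ℤ)) atTop (𝓝 p) ∧
    Tendsto (fun N : ℕ => ∑ n ∈ Finset.range N, (z ^ (n + 1))⁻¹ • f (-((n : ℤ) + 1)))
      atTop (𝓝 q) ∧
    s = p + q

/-- The sum of the Laurent series `f` on `annulus rm rp` belongs to `Hol(annulus rm ∞, F)`, that is,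
it has a holomorphic extension to `annulus rm ∞`. -/
def ExtendsToInfinity {F : Type*} [NormedAddCommGroup F] [NormedSpace ℂ F]
    (rm rp : ℝ≥0∞) (f : ℤ → F) : Prop :=
  ∃ G : ℂ → F, DifferentiableOn ℂ G (annulus rm ⊤) ∧
    ∀ z ∈ annulus rm rp, LaurentHasSum f z (G z)

/-- `T` is left-invertible, the (closed) subspace `E` generates `H` in both ways, and all
series `U_x` and `U'_x` converge on the annuli `A(rm, rp)` and `A(rm', rp')` respectively. -/
structure DualConvergence (T : H →L[ℂ] H) (E : Submodule ℂ H) [E.HasOrthogonalProjection]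
    (rm rp rm' rp' : ℝ≥0∞) : Prop where
  leftInvertible : IsLeftInvertible T
  span_eq_top : jointSpan (T†) (cauchyDual T) E = ⊤
  dual_span_eq_top : jointSpan ((cauchyDual T)†) T E = ⊤
  radius_lt : rm < rp
  dual_radius_lt : rm' < rp'
  converges : ∀ f ∈ modelSpace T E, ∀ z ∈ annulus rm rp, ∃ s : E, LaurentHasSum f z s
  dual_converges :
    ∀ g ∈ dualModelSpace T E, ∀ z ∈ annulus rm' rp', ∃ s : E, LaurentHasSum g z s

end Model

/-! ## Weighted composition operators -/

/-- The Hilbert space `ℓ²(X)`. -/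
abbrev EllTwo (X : Type*) : Type _ := lp (fun _ : X => ℂ) 2

/-- The bounded operator `T` on `ℓ²(X)` is the weighted composition operator
`C_{φ,w} f = w (f ∘ φ)`. -/
def IsWeightedComposition {X : Type*} (φ : X → X) (w : X → ℂ)
    (T : EllTwo X →L[ℂ] EllTwo X) : Prop :=
  ∀ (f : EllTwo X) (x : X), T f x = w x * f (φ x)

section WeightedComposition

open scoped Classical

variable {X : Type*}

/-- The basis vector `e_x` of `ℓ²(X)`. -/
def basisVec (x : X) : EllTwo X := lp.single 2 x (1 : ℂ)

/-- `ℓ²(S)` for `S ⊆ X`, as the subspace of `ℓ²(X)` of all functions vanishing off `S`. -/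
def supportedOn (S : Set X) : Submodule ℂ (EllTwo X) where
  carrier := {f | ∀ x, x ∉ S → f x = 0}
  add_mem' := by
    intro f g hf hg x hx
    simp [hf x hx, hg x hx]
  zero_mem' := by
    intro x _
    simp
  smul_mem' := by
    intro c f hf x hx
    simp [hf x hx]

theorem isClosed_supportedOn (S : Set X) : IsClosed (supportedOn S : Set (EllTwo X)) := by
  have : (supportedOn S : Set (EllTwo X)) = ⋂ x ∈ Sᶜ, {f : EllTwo X | f x = 0} := by
    ext f
    simp only [Set.mem_iInter, Set.mem_compl_iff, Set.mem_ofPred_eq]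
    exact Iff.rfl
  rw [this]
  refine isClosed_biInter fun x _ => ?_
  exact isClosed_eq ((continuous_apply x).comp
    (lp.uniformContinuous_coe (E := fun _ : X => ℂ) (p := 2)).continuous) continuous_const

instance instCompleteSpaceSupportedOn (S : Set X) : CompleteSpace (supportedOn S) :=
  (isClosed_supportedOn S).completeSpace_coe

theorem IsWeightedComposition.mapsTo_descendants {φ : X → X} {w : X → ℂ}
    {T : EllTwo X →L[ℂ] EllTwo X} (hT : IsWeightedComposition φ w T) (x : X) :
    Set.MapsTo T (supportedOn (descendants φ x)) (supportedOn (descendants φ x)) := by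
  intro f hf y hy
  have h : φ y ∉ descendants φ x := by
    rintro ⟨n, hn⟩
    exact hy ⟨n + 1, by simpa only [iterate_succ_apply] using hn⟩
  rw [hT f y, hf _ h, mul_zero]

/-- `𝓝((C_{φ,w}|_{ℓ²(Des(x))})^*)`, as a subspace of `ℓ²(X)`: the kernel of the adjoint of the
restriction of `C_{φ,w}` to its invariant subspace `ℓ²(Des(x))`. -/
def kerAdjointRestrict {φ : X → X} {w : X → ℂ} {T : EllTwo X →L[ℂ] EllTwo X}
    (hT : IsWeightedComposition φ w T) (x : X) : Submodule ℂ (EllTwo X) :=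
  (LinearMap.ker ((T.restrict (hT.mapsTo_descendants x))†).toLinearMap).map
    (supportedOn (descendants φ x)).subtype

/-- The subspace `E`. If `φ` has a cycle, it is the closed span of the vectors `e_x` and the
subspaces `𝓝((C_{φ,w}|_{ℓ²(Des(x))})^*)` over all `x` with `[φ](x) = 1` (the value of `Ω` is
then irrelevant); otherwise it is `⟨e_Ω⟩ ⊕ 𝓝(C_{φ,w}^*)`, where `Ω` is a generalized root. -/
def wanderingSubspace {φ : X → X} {w : X → ℂ} {T : EllTwo X →L[ℂ] EllTwo X}
    (hT : IsWeightedComposition φ w T) (Ω : X) : Submodule ℂ (EllTwo X) :=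
  (if HasCycle φ then
      ⨆ x ∈ {x : X | generation φ (φ Ω) x = 1},
        (Submodule.span ℂ {basisVec x} ⊔ kerAdjointRestrict hT x)
    else
      Submodule.span ℂ {basisVec Ω} ⊔ LinearMap.ker (T†).toLinearMap).topologicalClosure

instance instCompleteSpaceWanderingSubspace {φ : X → X} {w : X → ℂ}
    {T : EllTwo X →L[ℂ] EllTwo X} (hT : IsWeightedComposition φ w T) (Ω : X) :
    CompleteSpace (wanderingSubspace hT Ω) :=
  (Submodule.isClosed_topologicalClosure _).completeSpace_coe

end WeightedComposition

end

/-!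
Write `S = T' = cauchyDual T`, so that `T* S = 1`, and let `x = U⁻¹ f`, `y = U'⁻¹ g`. The Cauchy
pairing of `f = U_x` and `g = U'_y` is compared with `⟨x, y⟩` in three steps.

*Convergence.* If the sum of `U_x` extends holomorphically to `A(r⁻, ∞)`, then the regular part of
`U_x` is an entire function (`ExtendsToInfinity.radius_eq_top`), so its coefficients decay faster
than any geometric sequence, while those of the principal part are `O(ρⁿ)` for some `ρ < 1`.
Whatever `y` is, this beats the growth of the coefficients of `U'_y`, and the pairing converges
absolutely (`ExtendsToInfinity.summable_norm_mul_norm`).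

*Boundedness.* For fixed `x` the pairing is therefore a pointwise limit of bounded functionals of
`y`, hence bounded by the Banach–Steinhaus theorem (`exists_hasSum_pairing`). So it is
enough to identify it for `y` in a set with dense span, such as the vectors `Sᵏ e` and `T*ᵏ e`
with `e ∈ E`, whose closed span is `[E]_{T*,T'} = ℓ²(X)`.

*Identification.* Let `A ⊆ X` be the cycle, or the set of strict ancestors of `Ω` if there is no
cycle. This set (a *trunk*, `IsTrunk`) is forward invariant and `φ` is injective on it. The space
`E` lies in `ℓ²(X \ A)` and `T*` maps it into `ℓ²(A)`; as `T*T` is diagonal, it follows that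
`E` is orthogonal to `Tⁿ E` and `Sⁿ E` for all `n ≥ 1`. For `y = Sᵏ e` this leaves a single
nonzero term in the pairing, and it equals `⟨x, y⟩` (`hasSum_pairing_cauchyDual_pow`). For `k ≥ 1`
the vector `T*ᵏ e` is, for `e` in a generating set of `E`, a multiple of a basis vector `e_c` with
`c ∈ A`. Since `S e_c` is a vector of `E` plus a multiple of `e_v`, where `v ∈ A` is the
preimage of `c` in the trunk (if there is one), the relation `⟨x, e_c⟩ = ⟨T x, S e_c⟩` can be
iterated (`pairingResidual_succ`). After `N` steps the error is `x(c)`, up to conjugation, times a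
product of `N` ratios `|w(v)|² / ‖T e_{φ v}‖² ≤ 1` along the trunk (`IsTrunk.pairingResidual_eq`).
Without a cycle the iteration stops at `φ Ω`, which has no preimage in `A`. On a cycle, the same
ratios recur at every turn, and one of them is less than one if a nonzero weight leads into the
cycle from outside (`IsTrunk.residualsVanish_of_subset_periodicPts`); otherwise `T*ᵏ e = 0`.
-/

noncomputable section

/-! ### Coefficient bounds for Laurent series -/

section LaurentBounds

theorem tendsto_zero_of_tendsto_sum_range {F : Type*} [NormedAddCommGroup F] {u : ℕ → F} {s : F}
    (h : Tendsto (fun N => ∑ n ∈ Finset.range N, u n) atTop (𝓝 s)) :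
    Tendsto u atTop (𝓝 0) := by
  have h1 := ((tendsto_add_atTop_iff_nat 1).2 h).sub h
  simpa [Finset.sum_range_succ] using h1

variable {F : Type*} [NormedAddCommGroup F] [NormedSpace ℂ F]

/-- The power series `∑ zⁿ • a n` as a formal multilinear series. -/
def coeffSeries (a : ℕ → F) : FormalMultilinearSeries ℂ ℂ F :=
  fun n => ContinuousMultilinearMap.mkPiRing ℂ (Fin n) (a n)

theorem coeffSeries_apply (a : ℕ → F) (n : ℕ) (z : ℂ) :
    coeffSeries a n (fun _ => z) = z ^ n • a n := by
  simp [coeffSeries]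

theorem norm_coeffSeries (a : ℕ → F) (n : ℕ) : ‖coeffSeries a n‖ = ‖a n‖ :=
  ContinuousMultilinearMap.norm_mkPiRing _

theorem enorm_le_radius_coeffSeries {a : ℕ → F} {z : ℂ} {s : F}
    (h : Tendsto (fun N => ∑ n ∈ Finset.range N, z ^ n • a n) atTop (𝓝 s)) :
    ‖z‖ₑ ≤ (coeffSeries a).radius := by
  refine (coeffSeries a).le_radius_of_tendsto (r := ‖z‖₊) (l := 0) ?_
  have := (tendsto_zero_of_tendsto_sum_range h).norm
  simp_rw [norm_coeffSeries]
  simpa [norm_smul, mul_comm] using this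

theorem exists_norm_mul_pow_le_of_tendsto {a : ℕ → F} {z : ℂ} {s : F}
    (h : Tendsto (fun N => ∑ n ∈ Finset.range N, z ^ n • a n) atTop (𝓝 s)) :
    ∃ C : ℝ, ∀ n, ‖a n‖ * ‖z‖ ^ n ≤ C := by
  obtain ⟨C, hC⟩ := (tendsto_zero_of_tendsto_sum_range h).norm.bddAbove_range
  refine ⟨C, fun n => ?_⟩
  have := hC ⟨n, rfl⟩
  simpa [norm_smul, mul_comm] using this

theorem coeffSeries_sum_eq [CompleteSpace F] {a : ℕ → F} {z : ℂ} {s : F}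
    (hz : ‖z‖ₑ < (coeffSeries a).radius)
    (h : Tendsto (fun N => ∑ n ∈ Finset.range N, z ^ n • a n) atTop (𝓝 s)) :
    (coeffSeries a).sum z = s := by
  have h1 : HasSum (fun n => coeffSeries a n fun _ => z) ((coeffSeries a).sum z) :=
    (coeffSeries a).hasSum (by simpa [Metric.mem_eball] using hz)
  simp only [coeffSeries_apply] at h1
  exact tendsto_nhds_unique h1.tendsto_sum_nat h

theorem isOpen_annulus (r R : ℝ≥0∞) : IsOpen (annulus r R) :=
  (isOpen_lt continuous_const continuous_enorm).inter
    (isOpen_lt continuous_enorm continuous_const)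

theorem exists_mem_annulus {r R : ℝ≥0∞} (h : r < R) : ∃ z : ℂ, z ∈ annulus r R := by
  obtain ⟨x, h1, h2⟩ := ENNReal.lt_iff_exists_nnreal_btwn.1 h
  refine ⟨(x : ℝ), ?_⟩
  have : ‖((x : ℝ) : ℂ)‖ₑ = x := by
    rw [← ofReal_norm]
    simp
  exact ⟨by rwa [this], by rwa [this]⟩

theorem differentiableOn_coeffSeries_sum [CompleteSpace F] (a : ℕ → F) :
    DifferentiableOn ℂ (coeffSeries a).sum {z | ‖z‖ₑ < (coeffSeries a).radius} := by
  rcases eq_or_ne (coeffSeries a).radius 0 with h | h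
  · simp [h, differentiableOn_empty]
  · have := ((coeffSeries a).hasFPowerSeriesOnBall (pos_iff_ne_zero.2 h)).differentiableOn
    refine this.mono fun z hz => ?_
    simpa [Metric.mem_eball] using hz

/-- Split a Laurent expansion into its regular part and the principal part, the latter being a
power series in `z⁻¹`. -/
theorem LaurentHasSum.eq_add [CompleteSpace F] {f : ℤ → F} {z : ℂ} {s : F}
    (h : LaurentHasSum f z s)
    (h1 : ‖z‖ₑ < (coeffSeries fun n : ℕ => f n).radius)
    (h2 : ‖z⁻¹‖ₑ < (coeffSeries fun n : ℕ => f (-((n : ℤ) + 1))).radius) :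
    s = (coeffSeries fun n : ℕ => f n).sum z +
      z⁻¹ • (coeffSeries fun n : ℕ => f (-((n : ℤ) + 1))).sum z⁻¹ := by
  obtain ⟨p, q, hp, hq, rfl⟩ := h
  rw [coeffSeries_sum_eq h1 hp]
  congr 1
  have h3 : HasSum (fun n => coeffSeries (fun n : ℕ => f (-((n : ℤ) + 1))) n fun _ => z⁻¹) _ :=
    (coeffSeries _).hasSum (x := z⁻¹) (by simpa [Metric.mem_eball] using h2)
  simp only [coeffSeries_apply] at h3
  have h4 := (h3.const_smul z⁻¹).tendsto_sum_nat
  refine tendsto_nhds_unique hq ?_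
  simpa only [smul_smul, ← inv_pow, ← pow_succ'] using h4

theorem LaurentHasSum.enorm_le_radius {f : ℤ → F} {z : ℂ} {s : F} (h : LaurentHasSum f z s) :
    ‖z‖ₑ ≤ (coeffSeries fun n : ℕ => f n).radius := by
  obtain ⟨p, q, hp, hq, rfl⟩ := h
  exact enorm_le_radius_coeffSeries hp

theorem LaurentHasSum.tendsto_principal {f : ℤ → F} {z : ℂ} {s : F} (hz : z ≠ 0)
    (h : LaurentHasSum f z s) : ∃ q, Tendsto (fun N : ℕ =>
      ∑ n ∈ Finset.range N, z⁻¹ ^ n • f (-((n : ℤ) + 1))) atTop (𝓝 q) := by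
  obtain ⟨p, q, hp, hq, rfl⟩ := h
  refine ⟨z • q, ?_⟩
  convert hq.const_smul z using 2 with N
  rw [Finset.smul_sum]
  refine Finset.sum_congr rfl fun n _ => ?_
  rw [smul_smul, pow_succ, mul_inv, mul_left_comm, mul_inv_cancel₀ hz, mul_one, inv_pow]

theorem LaurentHasSum.enorm_inv_le_radius {f : ℤ → F} {z : ℂ} {s : F} (hz : z ≠ 0)
    (h : LaurentHasSum f z s) :
    ‖z⁻¹‖ₑ ≤ (coeffSeries fun n : ℕ => f (-((n : ℤ) + 1))).radius := by
  obtain ⟨q, hq⟩ := h.tendsto_principal hz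
  exact enorm_le_radius_coeffSeries hq

theorem ne_zero_of_mem_annulus {r R : ℝ≥0∞} {z : ℂ} (hz : z ∈ annulus r R) : z ≠ 0 := by
  rintro rfl
  simpa using hz.1

/-- If the sum of a Laurent series extends holomorphically to the exterior of a disc, the
regular part of the series is entire: subtracting the principal part, which is holomorphic
outside the disc anyway, glues the regular part to a function on all of `ℂ`. -/
theorem ExtendsToInfinity.radius_eq_top [CompleteSpace F] {rm rp : ℝ≥0∞} {f : ℤ → F}
    (hr : rm < rp) (hf : ExtendsToInfinity rm rp f) :
    (coeffSeries fun n : ℕ => f n).radius = ⊤ := by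
  obtain ⟨G, hG, hGf⟩ := hf
  set P := coeffSeries fun n : ℕ => f n with hP
  set Q := coeffSeries fun n : ℕ => f (-((n : ℤ) + 1)) with hQ
  have hPr : ∀ z : ℂ, ‖z‖ₑ < rp → ‖z‖ₑ < P.radius := by
    intro z hz
    obtain ⟨y, hy1, hy2⟩ := exists_mem_annulus (max_lt hr hz)
    exact ((le_max_right _ _).trans_lt hy1).trans_le
      (hGf y ⟨(le_max_left _ _).trans_lt hy1, hy2⟩).enorm_le_radius
  have hQr : ∀ z : ℂ, rm < ‖z‖ₑ → ‖z⁻¹‖ₑ < Q.radius := by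
    intro z hz
    obtain ⟨y, hy1, hy2⟩ := exists_mem_annulus (lt_min hr hz)
    have hy : y ∈ annulus rm rp := ⟨hy1, hy2.trans_le (min_le_left _ _)⟩
    have hy0 := ne_zero_of_mem_annulus hy
    refine lt_of_lt_of_le ?_ ((hGf y hy).enorm_inv_le_radius hy0)
    have hz0 : z ≠ 0 := by
      rintro rfl
      simp at hz
    rw [enorm_inv hz0, enorm_inv hy0, ENNReal.inv_lt_inv]
    exact hy2.trans_le (min_le_right _ _)
  -- `K` is the regular part inside the circle of radius `R` and its continuation outside; both
  -- formulas agree on the annulus `rm < ‖z‖ < rp`.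
  obtain ⟨R, hR1, hR2⟩ := ENNReal.lt_iff_exists_nnreal_btwn.1 hr
  classical
  let K : ℂ → F := fun z => if ‖z‖ₑ < R then P.sum z else G z - z⁻¹ • Q.sum z⁻¹
  have hK1 : ∀ z : ℂ, ‖z‖ₑ < rp → K z = P.sum z := by
    intro z hz
    simp only [K]
    split_ifs with h
    · rfl
    · have hz' : rm < ‖z‖ₑ := hR1.trans_le (not_lt.1 h)
      rw [sub_eq_iff_eq_add]
      exact (hGf z ⟨hz', hz⟩).eq_add (hPr z hz) (hQr z hz')
  have hK2 : ∀ z : ℂ, rm < ‖z‖ₑ → K z = G z - z⁻¹ • Q.sum z⁻¹ := by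
    intro z hz
    by_cases h : ‖z‖ₑ < R
    · rw [hK1 z (h.trans hR2), eq_comm, sub_eq_iff_eq_add]
      exact (hGf z ⟨hz, h.trans hR2⟩).eq_add (hPr z (h.trans hR2)) (hQr z hz)
    · simp only [K, if_neg h]
  have hKd : Differentiable ℂ K := by
    intro z
    rcases lt_or_ge ‖z‖ₑ rp with hz | hz
    · have ho : {z : ℂ | ‖z‖ₑ < rp} ∈ 𝓝 z :=
        (isOpen_lt continuous_enorm continuous_const).mem_nhds hz
      have h1 : DifferentiableAt ℂ P.sum z :=
        ((differentiableOn_coeffSeries_sum _).mono hPr).differentiableAt ho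
      exact h1.congr_of_eventuallyEq (by filter_upwards [ho] with y hy using hK1 y hy)
    · have hz' : rm < ‖z‖ₑ := hr.trans_le hz
      have ho : {z : ℂ | rm < ‖z‖ₑ} ∈ 𝓝 z :=
        (isOpen_lt continuous_const continuous_enorm).mem_nhds hz'
      have hz0 : z ≠ 0 := by
        rintro rfl
        simp at hz'
      have h1 : DifferentiableAt ℂ G z :=
        hG.differentiableAt ((isOpen_annulus rm ⊤).mem_nhds ⟨hz', by simp⟩)
      have h2 : DifferentiableAt ℂ Q.sum z⁻¹ :=
        (differentiableOn_coeffSeries_sum _).differentiableAt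
          ((isOpen_lt continuous_enorm continuous_const).mem_nhds (hQr z hz'))
      have h3 : DifferentiableAt ℂ (fun z : ℂ => z⁻¹) z := differentiableAt_inv hz0
      have h4 : DifferentiableAt ℂ (fun z : ℂ => Q.sum z⁻¹) z :=
        DifferentiableAt.comp (g := Q.sum) z h2 h3
      exact (h1.sub (h3.smul h4)).congr_of_eventuallyEq
        (by filter_upwards [ho] with y hy using hK2 y hy)
  have hR0 : 0 < P.radius := by
    simpa using hPr 0 (by simpa using (zero_le.trans_lt hr))
  have hB := hKd.hasFPowerSeriesOnBall 0 (R := 1) one_pos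
  have hA := P.hasFPowerSeriesOnBall hR0
  have hPe := HasFPowerSeriesAt.eq_formalMultilinearSeries_of_eventually
    hA.hasFPowerSeriesAt hB.hasFPowerSeriesAt (by
      have ho : {z : ℂ | ‖z‖ₑ < rp} ∈ 𝓝 (0 : ℂ) :=
        (isOpen_lt continuous_enorm continuous_const).mem_nhds
          (by simpa using (zero_le.trans_lt hr))
      filter_upwards [ho] with y hy using (hK1 y hy).symm)
  rw [hPe]
  exact top_unique hB.r_le

theorem summable_mul_of_le_geometric {a b : ℕ → ℝ} {r s C D : ℝ} (ha0 : ∀ n, 0 ≤ a n)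
    (hb0 : ∀ n, 0 ≤ b n) (hr : 0 < r) (hs : 0 < s) (hrs : 1 < r * s)
    (ha : ∀ n, a n * r ^ n ≤ C) (hb : ∀ n, b n * s ^ n ≤ D) :
    Summable fun n => a n * b n := by
  have hC : 0 ≤ C := (mul_nonneg (ha0 0) (by positivity)).trans (ha 0)
  refine Summable.of_nonneg_of_le (fun n => mul_nonneg (ha0 n) (hb0 n))
    (f := fun n => C * D * ((r * s)⁻¹) ^ n) (fun n => ?_)
    ((summable_geometric_of_lt_one (by positivity) (inv_lt_one_of_one_lt₀ hrs)).mul_left _)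
  have h1 : (a n * r ^ n) * (b n * s ^ n) ≤ C * D :=
    mul_le_mul (ha n) (hb n) (mul_nonneg (hb0 n) (by positivity)) hC
  rw [inv_pow, ← div_eq_mul_inv, le_div_iff₀ (by positivity), mul_pow]
  linarith [h1]

/-- The Cauchy pairing of two Laurent series converges absolutely if the first one extends
holomorphically to `annulus rm ∞` and the annuli of convergence satisfy `rm < 1` and
`rm' ≤ 1`. -/
theorem ExtendsToInfinity.summable_norm_mul_norm [CompleteSpace F] {rm rp rm' rp' : ℝ≥0∞}
    (hr : rm < rp) (hr' : rm' < rp') (hrm : rm < 1) (hrm' : rm' ≤ 1) {f g : ℤ → F}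
    (hf : ExtendsToInfinity rm rp f)
    (hg : ∀ z ∈ annulus rm' rp', ∃ s, LaurentHasSum g z s) :
    Summable fun n : ℤ => ‖f n‖ * ‖g n‖ := by
  refine Summable.of_nat_of_neg_add_one ?_ ?_
  -- Regular parts: `g n = O(‖z‖⁻ⁿ)` for some `z ≠ 0`, and `f n = O((‖z‖ / 2)ⁿ)`.
  · obtain ⟨z, hz⟩ := exists_mem_annulus hr'
    obtain ⟨s, p, q, hp, -⟩ := hg z hz
    obtain ⟨D, hD⟩ := exists_norm_mul_pow_le_of_tendsto hp
    have hz0 : 0 < ‖z‖ := norm_pos_iff.2 (ne_zero_of_mem_annulus hz)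
    obtain ⟨C, -, hC⟩ := (coeffSeries fun n : ℕ => f n).norm_mul_pow_le_of_lt_radius
      (r := (2 * ‖z‖⁻¹).toNNReal) (by rw [hf.radius_eq_top hr]; exact ENNReal.coe_lt_top)
    refine summable_mul_of_le_geometric (r := 2 * ‖z‖⁻¹) (s := ‖z‖) (C := C) (D := D)
      (fun _ => norm_nonneg _) (fun _ => norm_nonneg _) (by positivity) hz0 ?_ (fun n => ?_) hD
    · rw [mul_assoc, inv_mul_cancel₀ hz0.ne']
      norm_num
    · have := hC n
      rwa [norm_coeffSeries, Real.coe_toNNReal _ (by positivity)] at this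
  -- Principal parts: `f (-n) = O(‖z‖ⁿ)` and `g (-n) = O(‖y‖ⁿ)` with `‖z‖ * ‖y‖ < 1`; such a `y`
  -- exists because `rm' ≤ 1 < ‖z‖⁻¹`.
  · obtain ⟨z, hz1, hz2⟩ := exists_mem_annulus (lt_min hr hrm)
    have hz : z ∈ annulus rm rp := ⟨hz1, hz2.trans_le (min_le_left _ _)⟩
    have hz0 := ne_zero_of_mem_annulus hz
    have hzlt : ‖z‖ₑ < 1 := hz2.trans_le (min_le_right _ _)
    obtain ⟨y, hy1, hy2⟩ := exists_mem_annulus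
      (lt_min hr' (hrm'.trans_lt (ENNReal.one_lt_inv.2 hzlt)))
    have hy : y ∈ annulus rm' rp' := ⟨hy1, hy2.trans_le (min_le_left _ _)⟩
    have hy0 := ne_zero_of_mem_annulus hy
    have hyz : ‖y‖ₑ < ‖z⁻¹‖ₑ := by
      rw [enorm_inv hz0]
      exact hy2.trans_le (min_le_right _ _)
    obtain ⟨G, -, hG⟩ := hf
    obtain ⟨q, hq⟩ := (hG z hz).tendsto_principal hz0
    obtain ⟨s, hs⟩ := hg y hy
    obtain ⟨q', hq'⟩ := hs.tendsto_principal hy0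
    obtain ⟨C, hC⟩ := exists_norm_mul_pow_le_of_tendsto hq
    obtain ⟨D, hD⟩ := exists_norm_mul_pow_le_of_tendsto hq'
    refine summable_mul_of_le_geometric (r := ‖z⁻¹‖) (s := ‖y⁻¹‖) (C := C) (D := D)
      (fun _ => norm_nonneg _) (fun _ => norm_nonneg _) (by simpa using hz0) (by simpa using hy0)
      ?_ hC hD
    have h1 : ‖y‖ < ‖z⁻¹‖ := by
      rwa [← ofReal_norm, ← ofReal_norm,
        ENNReal.ofReal_lt_ofReal_iff_of_nonneg (norm_nonneg _)] at hyz
    rw [norm_inv y, ← div_eq_mul_inv, one_lt_div (norm_pos_iff.2 hy0)]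
    exact h1

end LaurentBounds

/-! ### The Cauchy pairing for a left-invertible operator -/

section Pairing

variable {H : Type*} [NormedAddCommGroup H] [InnerProductSpace ℂ H]

/-- The `n`-th coefficient of the formal Laurent series `laurentMap A B E x`, as a bounded
operator in `x`. -/
def laurentCoeff (A B : H →L[ℂ] H) (E : Submodule ℂ H) [E.HasOrthogonalProjection] :
    ℤ → H →L[ℂ] E
  | Int.ofNat n => E.orthogonalProjectionOnto ∘L B ^ n
  | Int.negSucc n => E.orthogonalProjectionOnto ∘L A ^ (n + 1)

theorem laurentMap_apply (A B : H →L[ℂ] H) (E : Submodule ℂ H) [E.HasOrthogonalProjection]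
    (x : H) (n : ℤ) : laurentMap A B E x n = laurentCoeff A B E n x := by
  cases n <;> rfl

variable [CompleteSpace H]

theorem adjoint_pow (T : H →L[ℂ] H) (n : ℕ) : (T†) ^ n = (T ^ n)† := by
  simp only [← ContinuousLinearMap.star_eq_adjoint, star_pow]

theorem IsLeftInvertible.isUnit_adjoint_comp {T : H →L[ℂ] H} (hT : IsLeftInvertible T) :
    IsUnit (T† ∘L T) := by
  obtain ⟨S, hS⟩ := hT
  refine ContinuousLinearMap.isUnit_of_forall_le_norm_inner_map _ (c := ((‖S‖₊ + 1) ^ 2)⁻¹)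
    (by positivity) fun x => ?_
  rw [ContinuousLinearMap.comp_apply, ContinuousLinearMap.adjoint_inner_left,
    inner_self_eq_norm_sq_to_K, norm_pow, RCLike.norm_ofReal, abs_norm]
  have h1 : ‖x‖ ≤ (‖S‖ + 1) * ‖T x‖ := by
    calc ‖x‖ = ‖S (T x)‖ := by
          rw [← ContinuousLinearMap.comp_apply, hS, ContinuousLinearMap.id_apply]
      _ ≤ ‖S‖ * ‖T x‖ := S.le_opNorm _
      _ ≤ (‖S‖ + 1) * ‖T x‖ := by gcongr; linarith
  have h2 := pow_le_pow_left₀ (norm_nonneg x) h1 2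
  rw [mul_pow] at h2
  push_cast
  rw [← div_eq_mul_inv, div_le_iff₀ (by positivity)]
  linarith

theorem IsLeftInvertible.adjoint_cauchyDual_apply {T : H →L[ℂ] H} (hT : IsLeftInvertible T)
    (x : H) : (T†) (cauchyDual T x) = x :=
  DFunLike.congr_fun (Ring.mul_inverse_cancel (T† ∘L T) hT.isUnit_adjoint_comp) x

theorem IsLeftInvertible.adjoint_cauchyDual_pow_apply {T : H →L[ℂ] H} (hT : IsLeftInvertible T)
    (n : ℕ) (x : H) : ((T†) ^ n) ((cauchyDual T ^ n) x) = x := by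
  have h : T† * cauchyDual T = 1 := by
    ext y
    exact hT.adjoint_cauchyDual_apply y
  have h2 : (T†) ^ n * cauchyDual T ^ n = 1 := by
    induction n with
    | zero => simp
    | succ n ih =>
      rw [pow_succ, pow_succ' (cauchyDual T), mul_assoc, ← mul_assoc (T†), h, one_mul, ih]
  exact DFunLike.congr_fun h2 x

/-- By the Banach–Steinhaus theorem, a Cauchy pairing with a fixed sequence which converges on all
of `H` is a bounded functional. -/
theorem exists_hasSum_pairing (A B : H →L[ℂ] H) (E : Submodule ℂ H) [E.HasOrthogonalProjection]
    (a : ℤ → E) (h : ∀ y, Summable fun n => inner ℂ (a n) (laurentCoeff A B E n y)) :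
    ∃ ψ : H →L[ℂ] ℂ, ∀ y, HasSum (fun n => inner ℂ (a n) (laurentCoeff A B E n y)) (ψ y) := by
  let F : Finset ℤ → H →L[ℂ] ℂ := fun s => ∑ n ∈ s, innerSL ℂ (a n) ∘L laurentCoeff A B E n
  have hF : Tendsto (fun s y => F s y) atTop
      (𝓝 fun y => ∑' n, inner ℂ (a n) (laurentCoeff A B E n y)) := by
    rw [tendsto_pi_nhds]
    intro y
    have h1 := (h y).hasSum
    simpa [HasSum, F, sum_apply] using h1
  exact ⟨continuousLinearMapOfTendsto F hF, fun y => (h y).hasSum⟩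

/-- All the images `Cⁿ E`, `n ≥ 1`, are orthogonal to `E`. -/
def IsWandering (C : H →L[ℂ] H) (E : Submodule ℂ H) : Prop :=
  ∀ n : ℕ, ∀ e ∈ E, (C ^ (n + 1)) e ∈ Eᗮ

theorem IsWandering.adjoint {C : H →L[ℂ] H} {E : Submodule ℂ H} (h : IsWandering C E) :
    IsWandering (C†) E := by
  intro n e he
  rw [Submodule.mem_orthogonal]
  intro e' he'
  rw [adjoint_pow, ContinuousLinearMap.adjoint_inner_right]
  exact Submodule.inner_left_of_mem_orthogonal he (h n e' he')

variable {T : H →L[ℂ] H} {E : Submodule ℂ H} [E.HasOrthogonalProjection]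

/-- For `y = T'^k e` the Cauchy pairing has a single nonzero term, that of index `k`. -/
theorem hasSum_pairing_cauchyDual_pow (hT : IsLeftInvertible T) (hT1 : IsWandering T E)
    (hT2 : IsWandering (cauchyDual T) E) (x : H) (k : ℕ) {e : H} (he : e ∈ E) :
    HasSum (fun n => inner ℂ (laurentCoeff T ((cauchyDual T)†) E n x)
      (laurentCoeff (cauchyDual T) (T†) E n ((cauchyDual T ^ k) e)))
      (inner ℂ x ((cauchyDual T ^ k) e)) := by
  have key : inner ℂ (laurentCoeff T ((cauchyDual T)†) E k x)
      (laurentCoeff (cauchyDual T) (T†) E k ((cauchyDual T ^ k) e)) =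
      inner ℂ x ((cauchyDual T ^ k) e) := by
    change inner ℂ (E.orthogonalProjectionOnto ((((cauchyDual T)†) ^ k) x))
      (E.orthogonalProjectionOnto (((T†) ^ k) ((cauchyDual T ^ k) e))) = _
    rw [hT.adjoint_cauchyDual_pow_apply,
      E.orthogonalProjectionOnto_mem_subspace_eq_self ⟨e, he⟩,
      Submodule.inner_orthogonalProjectionOnto_eq_of_mem_right, adjoint_pow,
      ContinuousLinearMap.adjoint_inner_left]
  rw [← key]
  refine hasSum_single (k : ℤ) fun n hn => ?_
  have h0 : laurentCoeff (cauchyDual T) (T†) E n ((cauchyDual T ^ k) e) = 0 := by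
    rcases n with n | n
    · change E.orthogonalProjectionOnto (((T†) ^ n) ((cauchyDual T ^ k) e)) = 0
      rw [Submodule.orthogonalProjectionOnto_eq_zero_iff]
      have hnk : n ≠ k := fun h => hn (by simp [h])
      rcases hnk.lt_or_gt with h | h
      · obtain ⟨m, rfl⟩ := Nat.exists_eq_add_of_lt h
        rw [add_assoc, pow_add, mul_apply_eq_comp,
          hT.adjoint_cauchyDual_pow_apply]
        exact hT2 m e he
      · obtain ⟨m, rfl⟩ := Nat.exists_eq_add_of_lt h
        rw [show k + m + 1 = (m + 1) + k by ring, pow_add, mul_apply_eq_comp,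
          hT.adjoint_cauchyDual_pow_apply]
        exact hT1.adjoint m e he
    · change E.orthogonalProjectionOnto ((cauchyDual T ^ (n + 1)) ((cauchyDual T ^ k) e)) = 0
      rw [← mul_apply_eq_comp, ← pow_add,
        Submodule.orthogonalProjectionOnto_eq_zero_iff, add_right_comm]
      exact hT2 _ e he
  rw [h0, inner_zero_right]

variable (T E) in
/-- The difference between `⟨x, y⟩` and the first `N` terms of the principal part of the Cauchy
pairing of `U_x` and `U'_y`. -/
def pairingResidual (N : ℕ) (x y : H) : ℂ :=
  inner ℂ x y - ∑ n ∈ Finset.range N, inner ℂ (E.orthogonalProjectionOnto ((T ^ (n + 1)) x))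
    (E.orthogonalProjectionOnto ((cauchyDual T ^ (n + 1)) y))

theorem pairingResidual_zero (x y : H) : pairingResidual T E 0 x y = inner ℂ x y := by
  simp [pairingResidual]

theorem pairingResidual_succ (hT : IsLeftInvertible T) (hT2 : IsWandering (cauchyDual T) E) (N : ℕ)
    (x : H) {c v : H} {β : ℂ} (hv : v ∈ Eᗮ) (hm : cauchyDual T c - β • v ∈ E) :
    pairingResidual T E (N + 1) x c = β * pairingResidual T E N (T x) v := by
  obtain ⟨m, hmE, hm⟩ : ∃ m ∈ E, cauchyDual T c = β • v + m := ⟨_, hm, by abel⟩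
  have h1 : inner ℂ x c = β * inner ℂ (T x) v + inner ℂ (T x) m := by
    rw [← hT.adjoint_cauchyDual_apply c, ContinuousLinearMap.adjoint_inner_right, hm,
      inner_add_right, inner_smul_right]
  have h2 : inner ℂ (E.orthogonalProjectionOnto ((T ^ (0 + 1)) x))
      (E.orthogonalProjectionOnto ((cauchyDual T ^ (0 + 1)) c)) = inner ℂ (T x) m := by
    rw [zero_add, pow_one, pow_one, hm, map_add, map_smul,
      Submodule.orthogonalProjectionOnto_apply_of_mem_orthogonal hv, smul_zero, zero_add,
      E.orthogonalProjectionOnto_mem_subspace_eq_self ⟨m, hmE⟩,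
      Submodule.inner_orthogonalProjectionOnto_eq_of_mem_right]
  have h3 : ∀ n : ℕ, inner ℂ (E.orthogonalProjectionOnto ((T ^ (n + 1 + 1)) x))
      (E.orthogonalProjectionOnto ((cauchyDual T ^ (n + 1 + 1)) c)) =
      β * inner ℂ (E.orthogonalProjectionOnto ((T ^ (n + 1)) (T x)))
        (E.orthogonalProjectionOnto ((cauchyDual T ^ (n + 1)) v)) := by
    intro n
    rw [pow_succ T (n + 1), pow_succ (cauchyDual T) (n + 1),
      mul_apply_eq_comp, mul_apply_eq_comp, hm, map_add,
      map_add, map_smul, map_smul,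
      Submodule.orthogonalProjectionOnto_apply_of_mem_orthogonal (hT2 n m hmE), add_zero,
      inner_smul_right]
  simp only [pairingResidual, Finset.sum_range_succ', h1, h2, h3, ← Finset.mul_sum]
  ring

/-- If `T*ⁿ y ⟂ E` for all `n ≥ 0` and the residuals of `y` tend to zero along a
subsequence, then the Cauchy pairing of `U_x` and `U'_y` is `⟨x, y⟩`. -/
theorem pairing_eq_of_tendsto_residual {x y : H} {s : ℂ}
    (hs : HasSum (fun n => inner ℂ (laurentCoeff T ((cauchyDual T)†) E n x)
      (laurentCoeff (cauchyDual T) (T†) E n y)) s)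
    (hy : ∀ n : ℕ, ((T†) ^ n) y ∈ Eᗮ) {u : ℕ → ℕ} (hu : Tendsto u atTop atTop)
    (hr : Tendsto (fun j => pairingResidual T E (u j) x y) atTop (𝓝 0)) :
    s = inner ℂ x y := by
  have hpos : ∀ n : ℤ, n ∉ Set.range Int.negSucc →
      inner ℂ (laurentCoeff T ((cauchyDual T)†) E n x)
        (laurentCoeff (cauchyDual T) (T†) E n y) = 0 := by
    rintro (n | n) hn
    · change inner ℂ _ (E.orthogonalProjectionOnto (((T†) ^ n) y)) = 0
      rw [Submodule.orthogonalProjectionOnto_apply_of_mem_orthogonal (hy n), inner_zero_right]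
    · exact absurd ⟨n, rfl⟩ hn
  have hinj : Injective Int.negSucc := fun _ _ => Int.negSucc.inj
  have h1 := ((hinj.hasSum_iff hpos).2 hs).tendsto_sum_nat.comp hu
  have h2 := h1.add hr
  rw [add_zero] at h2
  refine tendsto_nhds_unique (h2.congr fun j => ?_) tendsto_const_nhds
  exact add_sub_cancel _ _

end Pairing

/-! ### Weighted composition operators -/

section Weighted

variable {X : Type*}

theorem basisVec_apply_self (x : X) : basisVec x x = 1 := by
  classical
  simp [basisVec]

theorem basisVec_apply_of_ne {x y : X} (h : y ≠ x) : basisVec x y = 0 := by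
  classical
  simp [basisVec, h]

theorem inner_basisVec_left (x : X) (f : EllTwo X) : inner ℂ (basisVec x) f = f x := by
  classical
  rw [basisVec, lp.inner_single_left]
  simp

theorem inner_basisVec_right (x : X) (f : EllTwo X) :
    inner ℂ f (basisVec x) = (starRingEnd ℂ) (f x) := by
  rw [← inner_conj_symm, inner_basisVec_left]

theorem basisVec_mem_supportedOn {S : Set X} {x : X} (hx : x ∈ S) :
    basisVec x ∈ supportedOn S :=
  fun _ hy => basisVec_apply_of_ne fun h => hy (h ▸ hx)

theorem inner_eq_zero_of_forall {f g : EllTwo X} (h : ∀ x, f x = 0 ∨ g x = 0) :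
    inner ℂ f g = 0 := by
  rw [lp.inner_eq_tsum, ← tsum_zero (α := ℂ) (β := X)]
  congr 1
  ext x
  rcases h x with h | h <;> simp [h]

theorem supportedOn_isOrtho {S : Set X} {f g : EllTwo X} (hf : f ∈ supportedOn S)
    (hg : g ∈ supportedOn Sᶜ) : inner ℂ f g = 0 := by
  refine inner_eq_zero_of_forall fun x => ?_
  by_cases hx : x ∈ S
  · exact Or.inr (hg x (by simpa using hx))
  · exact Or.inl (hf x hx)

variable {φ : X → X} {w : X → ℂ} {T : EllTwo X →L[ℂ] EllTwo X}

theorem IsWeightedComposition.apply_basisVec_map (hT : IsWeightedComposition φ w T) (x : X) :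
    T (basisVec (φ x)) x = w x := by
  rw [hT, basisVec_apply_self, mul_one]

theorem IsWeightedComposition.apply_basisVec_of_ne (hT : IsWeightedComposition φ w T) {x u : X}
    (h : φ x ≠ u) : T (basisVec u) x = 0 := by
  rw [hT, basisVec_apply_of_ne h, mul_zero]

theorem adjoint_apply_eq_inner (T : EllTwo X →L[ℂ] EllTwo X) (g : EllTwo X) (u : X) :
    (T†) g u = inner ℂ (T (basisVec u)) g := by
  rw [← inner_basisVec_left, ContinuousLinearMap.adjoint_inner_right]

theorem IsWeightedComposition.adjoint_basisVec (hT : IsWeightedComposition φ w T) (x : X) :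
    (T†) (basisVec x) = (starRingEnd ℂ) (w x) • basisVec (φ x) := by
  ext u
  rw [adjoint_apply_eq_inner, inner_basisVec_right, lp.coeFn_smul, Pi.smul_apply, smul_eq_mul]
  by_cases h : φ x = u
  · subst h
    rw [hT.apply_basisVec_map, basisVec_apply_self, mul_one]
  · rw [hT.apply_basisVec_of_ne h, basisVec_apply_of_ne (Ne.symm h), map_zero, mul_zero]

theorem IsWeightedComposition.adjoint_pow_basisVec (hT : IsWeightedComposition φ w T) (n : ℕ)
    (x : X) : ∃ c : ℂ, ((T†) ^ n) (basisVec x) = c • basisVec (φ^[n] x) := by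
  induction n with
  | zero => exact ⟨1, by simp⟩
  | succ n ih =>
    obtain ⟨c, hc⟩ := ih
    refine ⟨c * (starRingEnd ℂ) (w (φ^[n] x)), ?_⟩
    rw [pow_succ', mul_apply_eq_comp, hc, map_smul, hT.adjoint_basisVec,
      smul_smul, iterate_succ_apply']

theorem IsWeightedComposition.pow_apply (hT : IsWeightedComposition φ w T) (n : ℕ)
    (f : EllTwo X) (x : X) :
    (T ^ n) f x = (∏ i ∈ Finset.range n, w (φ^[i] x)) * f (φ^[n] x) := by
  induction n generalizing f with
  | zero => simp
  | succ n ih =>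
    rw [pow_succ, mul_apply_eq_comp, ih, hT, Finset.prod_range_succ,
      iterate_succ_apply', mul_assoc]

theorem IsWeightedComposition.inner_apply_basisVec_apply (hT : IsWeightedComposition φ w T)
    (u : X) (f : EllTwo X) :
    inner ℂ (T (basisVec u)) (T f) = (‖T (basisVec u)‖ ^ 2 : ℝ) * f u := by
  have h0 : inner ℂ (T (basisVec u)) (T f - f u • T (basisVec u)) = 0 := by
    refine inner_eq_zero_of_forall fun x => ?_
    by_cases h : φ x = u
    · subst h
      right
      rw [lp.coeFn_sub, Pi.sub_apply, lp.coeFn_smul, Pi.smul_apply, hT f, hT.apply_basisVec_map,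
        smul_eq_mul]
      ring
    · exact Or.inl (hT.apply_basisVec_of_ne h)
  rw [inner_sub_right, inner_smul_right, sub_eq_zero, inner_self_eq_norm_sq_to_K] at h0
  rw [h0, mul_comm]
  norm_cast

theorem IsLeftInvertible.apply_basisVec_ne_zero (hL : IsLeftInvertible T) (u : X) :
    T (basisVec u) ≠ 0 := by
  obtain ⟨S, hS⟩ := hL
  intro h
  have h1 : S (T (basisVec u)) = basisVec u := DFunLike.congr_fun hS (basisVec u)
  rw [h, map_zero] at h1
  have h2 := basisVec_apply_self u
  rw [← h1] at h2
  simp at h2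

theorem IsLeftInvertible.sq_norm_basisVec_pos (hL : IsLeftInvertible T) (u : X) :
    0 < ‖T (basisVec u)‖ ^ 2 := by
  have := norm_pos_iff.2 (hL.apply_basisVec_ne_zero u)
  positivity

/-- The weight of the Cauchy dual of `C_{φ,w}`, which is again a weighted composition operator
with symbol `φ`. -/
def dualWeight (φ : X → X) (w : X → ℂ) (T : EllTwo X →L[ℂ] EllTwo X) (x : X) : ℂ :=
  w x / (‖T (basisVec (φ x))‖ ^ 2 : ℝ)

theorem IsWeightedComposition.cauchyDual (hT : IsWeightedComposition φ w T)
    (hL : IsLeftInvertible T) :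
    IsWeightedComposition φ (dualWeight φ w T) (cauchyDual T) := by
  intro f x
  set r := Ring.inverse (T† ∘L T) f with hr
  have h1 : (T†) (T r) = f :=
    DFunLike.congr_fun (Ring.mul_inverse_cancel (T† ∘L T) hL.isUnit_adjoint_comp) f
  have h2 : (‖T (basisVec (φ x))‖ ^ 2 : ℝ) * r (φ x) = f (φ x) := by
    rw [← hT.inner_apply_basisVec_apply, ← adjoint_apply_eq_inner, h1]
  have h3 : ((‖T (basisVec (φ x))‖ ^ 2 : ℝ) : ℂ) ≠ 0 :=
    Complex.ofReal_ne_zero.2 (hL.sq_norm_basisVec_pos _).ne'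
  change T r x = _
  rw [hT, dualWeight, ← h2]
  field_simp

theorem IsWeightedComposition.cauchyDual_basisVec (hT : IsWeightedComposition φ w T)
    (hL : IsLeftInvertible T) (u : X) :
    _root_.cauchyDual T (basisVec u) = ((‖T (basisVec u)‖ ^ 2 : ℝ) : ℂ)⁻¹ • T (basisVec u) := by
  ext x
  rw [hT.cauchyDual hL, lp.coeFn_smul, Pi.smul_apply, hT, dualWeight, smul_eq_mul]
  by_cases h : φ x = u
  · subst h
    ring
  · rw [basisVec_apply_of_ne h]
    ring

theorem IsWeightedComposition.sum_sq_norm_le (hT : IsWeightedComposition φ w T) {z : X}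
    (s : Finset X) (hs : ∀ x ∈ s, φ x = z) : ∑ x ∈ s, ‖w x‖ ^ 2 ≤ ‖T (basisVec z)‖ ^ 2 := by
  have h := lp.sum_rpow_le_norm_rpow (p := 2) (by norm_num) (T (basisVec z)) s
  have h2 : (2 : ℝ≥0∞).toReal = ((2 : ℕ) : ℝ) := by norm_num
  simp only [h2, Real.rpow_natCast] at h
  refine (Finset.sum_le_sum fun x hx => ?_).trans h
  rw [← hs x hx, hT.apply_basisVec_map]

end Weighted

/-! ### Wandering subspaces sitting below a forward invariant set -/

section Trunk

variable {X : Type*} {φ : X → X} {w : X → ℂ} {T : EllTwo X →L[ℂ] EllTwo X}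

/-- A forward invariant set `A` (the *trunk*) on which `φ` is injective, such that `E` is the closed
linear span of some vectors vanishing on `A` and mapped by `T*` to multiples of `T* e_b`, where `b`
is a point entering `A` in one step. The basis vectors of all these entry points `b` belong
to `E`. -/
structure IsTrunk (φ : X → X) (T : EllTwo X →L[ℂ] EllTwo X) (A : Set X)
    (E : Submodule ℂ (EllTwo X)) : Prop where
  mapsTo : Set.MapsTo φ A A
  injOn : Set.InjOn φ A
  basisVec_mem : ∀ b ∉ A, φ b ∈ A → basisVec b ∈ E
  le_closure : E ≤ (Submodule.span ℂ {g | g ∈ supportedOn Aᶜ ∧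
    ∃ b ∉ A, φ b ∈ A ∧ ∃ α : ℂ, (T†) g = α • (T†) (basisVec b)}).topologicalClosure
  isClosed : IsClosed (E : Set (EllTwo X))

variable {A : Set X} {E : Submodule ℂ (EllTwo X)}

theorem IsTrunk.le_supportedOn (h : IsTrunk φ T A E) : E ≤ supportedOn Aᶜ :=
  h.le_closure.trans (Submodule.topologicalClosure_minimal _
    (Submodule.span_le.2 fun _ hg => hg.1) (isClosed_supportedOn _))

theorem IsTrunk.le_of_isClosed (h : IsTrunk φ T A E) {S : Submodule ℂ (EllTwo X)}
    (hS : IsClosed (S : Set (EllTwo X)))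
    (hg : ∀ g ∈ supportedOn Aᶜ, ∀ b ∉ A, φ b ∈ A → ∀ α : ℂ,
      (T†) g = α • (T†) (basisVec b) → g ∈ S) : E ≤ S :=
  h.le_closure.trans (Submodule.topologicalClosure_minimal _
    (Submodule.span_le.2 fun g ⟨h1, b, hb, hb', α, hα⟩ => hg g h1 b hb hb' α hα) hS)

theorem IsTrunk.adjoint_mem (h : IsTrunk φ T A E) (hT : IsWeightedComposition φ w T)
    {e : EllTwo X} (he : e ∈ E) : (T†) e ∈ supportedOn A := by
  have h1 : E ≤ (supportedOn A).comap (T†).toLinearMap := by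
    refine h.le_of_isClosed ((isClosed_supportedOn A).preimage (T†).continuous) ?_
    intro g _ b _ hb' α hα
    change (T†) g ∈ supportedOn A
    rw [hα, hT.adjoint_basisVec]
    exact Submodule.smul_mem _ _ (Submodule.smul_mem _ _ (basisVec_mem_supportedOn hb'))
  exact h1 he

theorem IsTrunk.mem_orthogonal (h : IsTrunk φ T A E) {f : EllTwo X} (hf : f ∈ supportedOn A) :
    f ∈ Eᗮ := by
  rw [Submodule.mem_orthogonal']
  exact fun e he => supportedOn_isOrtho hf (h.le_supportedOn he)

theorem IsWeightedComposition.pow_mem_supportedOn_compl (hT : IsWeightedComposition φ w T)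
    (hA : Set.MapsTo φ A A) {f : EllTwo X} (hf : f ∈ supportedOn Aᶜ) (n : ℕ) :
    (T ^ n) f ∈ supportedOn Aᶜ := by
  intro x hx
  rw [hT.pow_apply, hf _ fun h => h (hA.iterate n (by simpa using hx)), mul_zero]

theorem IsTrunk.isWandering (h : IsTrunk φ T A E) (hT : IsWeightedComposition φ w T) :
    IsWandering T E := by
  intro n e he
  rw [Submodule.mem_orthogonal]
  intro e' he'
  rw [pow_succ', mul_apply_eq_comp, ← ContinuousLinearMap.adjoint_inner_left]
  exact supportedOn_isOrtho (h.adjoint_mem hT he')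
    (hT.pow_mem_supportedOn_compl h.mapsTo (h.le_supportedOn he) n)

/-- `T'` maps `ℓ²(X \ A)` into `T ℓ²(X \ A)`, since `T*T` is diagonal. -/
theorem IsTrunk.isWandering_cauchyDual (h : IsTrunk φ T A E) (hT : IsWeightedComposition φ w T)
    (hL : IsLeftInvertible T) : IsWandering (cauchyDual T) E := by
  intro n e he
  rw [Submodule.mem_orthogonal]
  intro e' he'
  rw [pow_succ', mul_apply_eq_comp, ← ContinuousLinearMap.adjoint_inner_left]
  refine supportedOn_isOrtho (S := A) (fun u hu => ?_)
    ((hT.cauchyDual hL).pow_mem_supportedOn_compl h.mapsTo (h.le_supportedOn he) n)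
  rw [adjoint_apply_eq_inner, hT.cauchyDual_basisVec hL, inner_smul_left,
    ← adjoint_apply_eq_inner, h.adjoint_mem hT he' u hu, mul_zero]

theorem IsTrunk.mem_of_forall (h : IsTrunk φ T A E) {m : EllTwo X}
    (hm : ∀ x, m x ≠ 0 → x ∉ A ∧ φ x ∈ A) : m ∈ E := by
  have : CompleteSpace E := h.isClosed.completeSpace_coe
  rw [← Submodule.orthogonal_orthogonal E, Submodule.mem_orthogonal']
  intro f hf
  refine inner_eq_zero_of_forall fun x => ?_
  by_cases hx : m x = 0
  · exact Or.inl hx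
  · right
    rw [← inner_basisVec_left]
    exact Submodule.inner_right_of_mem_orthogonal
      (h.basisVec_mem x (hm x hx).1 (hm x hx).2) hf

/-- If `c` has no predecessor in the trunk, then `T' e_c` belongs to `E`. -/
theorem IsTrunk.cauchyDual_basisVec_mem (h : IsTrunk φ T A E) (hT : IsWeightedComposition φ w T)
    (hL : IsLeftInvertible T) {c : X} (hc : c ∈ A) (hcA : ∀ v ∈ A, φ v ≠ c) :
    cauchyDual T (basisVec c) ∈ E := by
  refine h.mem_of_forall fun x hx => ?_
  have hxc : φ x = c := by
    by_contra hne
    exact hx ((hT.cauchyDual hL).apply_basisVec_of_ne hne)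
  exact ⟨fun hxA => hcA x hxA hxc, hxc ▸ hc⟩

theorem IsTrunk.cauchyDual_basisVec_sub_mem (h : IsTrunk φ T A E)
    (hT : IsWeightedComposition φ w T) (hL : IsLeftInvertible T) {v : X} (hv : v ∈ A) :
    cauchyDual T (basisVec (φ v)) - dualWeight φ w T v • basisVec v ∈ E := by
  refine h.mem_of_forall fun x hx => ?_
  rw [lp.coeFn_sub, Pi.sub_apply, lp.coeFn_smul, Pi.smul_apply, smul_eq_mul] at hx
  have hxv : x ≠ v := by
    rintro rfl
    rw [(hT.cauchyDual hL).apply_basisVec_map, basisVec_apply_self] at hx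
    simp at hx
  rw [basisVec_apply_of_ne hxv, mul_zero, sub_zero] at hx
  have hφ : φ x = φ v := by
    by_contra hne
    exact hx ((hT.cauchyDual hL).apply_basisVec_of_ne hne)
  exact ⟨fun hxA => hxv (h.injOn hxA hv hφ), hφ ▸ h.mapsTo hv⟩

variable [E.HasOrthogonalProjection]

theorem IsTrunk.pairingResidual_iterate (h : IsTrunk φ T A E) (hT : IsWeightedComposition φ w T)
    (hL : IsLeftInvertible T) {v : X} (hv : v ∈ A) (N M : ℕ) (x : EllTwo X) :
    pairingResidual T E (N + M) x (basisVec (φ^[N] v)) =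
      (∏ i ∈ Finset.range N, dualWeight φ w T (φ^[i] v)) *
        pairingResidual T E M ((T ^ N) x) (basisVec v) := by
  induction N generalizing x with
  | zero => simp
  | succ N ih =>
    have hNv : φ^[N] v ∈ A := h.mapsTo.iterate N hv
    rw [add_right_comm, iterate_succ_apply',
      pairingResidual_succ hL (h.isWandering_cauchyDual hT hL) _ _
        (h.mem_orthogonal (basisVec_mem_supportedOn hNv))
        (h.cauchyDual_basisVec_sub_mem hT hL hNv), ih, Finset.prod_range_succ, pow_succ,
      mul_apply_eq_comp]
    ring

variable (φ w T) in
/-- The part of the mass of `T e_{φ v}` that sits at `v`. -/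
def massRatio (v : X) : ℝ :=
  ‖w v‖ ^ 2 / ‖T (basisVec (φ v))‖ ^ 2

theorem massRatio_nonneg (v : X) : 0 ≤ massRatio φ w T v := by
  unfold massRatio
  positivity

theorem massRatio_le_one (hT : IsWeightedComposition φ w T) (v : X) : massRatio φ w T v ≤ 1 := by
  have := hT.sum_sq_norm_le (z := φ v) {v} (by simp)
  rw [Finset.sum_singleton] at this
  exact div_le_one_of_le₀ this (by positivity)

theorem massRatio_lt_one (hT : IsWeightedComposition φ w T) {v b : X} (hb : b ≠ v)
    (hφ : φ b = φ v) (hw : w b ≠ 0) : massRatio φ w T v < 1 := by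
  classical
  have := hT.sum_sq_norm_le (z := φ v) {b, v} (by simp [hφ])
  rw [Finset.sum_pair hb] at this
  have hpos : 0 < ‖w b‖ ^ 2 := by
    have := norm_pos_iff.2 hw
    positivity
  rw [massRatio, div_lt_one (by linarith [sq_nonneg ‖w v‖])]
  linarith

theorem IsTrunk.pairingResidual_eq (h : IsTrunk φ T A E) (hT : IsWeightedComposition φ w T)
    (hL : IsLeftInvertible T) {v : X} (hv : v ∈ A) (N : ℕ) (x : EllTwo X) :
    pairingResidual T E N x (basisVec (φ^[N] v)) =
      (∏ i ∈ Finset.range N, massRatio φ w T (φ^[i] v) : ℝ) *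
        (starRingEnd ℂ) (x (φ^[N] v)) := by
  have h1 := h.pairingResidual_iterate hT hL hv N 0 x
  rw [add_zero] at h1
  rw [h1, pairingResidual_zero, inner_basisVec_right, hT.pow_apply, map_mul, map_prod,
    ← mul_assoc, ← Finset.prod_mul_distrib, Complex.ofReal_prod]
  congr 1
  refine Finset.prod_congr rfl fun i _ => ?_
  rw [dualWeight, massRatio, div_mul_eq_mul_div, Complex.mul_conj, Complex.normSq_eq_norm_sq]
  push_cast
  rfl

/-- The expansion of `e_c`, for the points `c` of the trunk reached from an entry point `b` along
nonzero weights, exhausts `e_c`: some subsequence of the residuals tends to zero. -/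
def ResidualsVanish (φ : X → X) (w : X → ℂ) (T : EllTwo X →L[ℂ] EllTwo X) (A : Set X)
    (E : Submodule ℂ (EllTwo X)) [E.HasOrthogonalProjection] : Prop :=
  ∀ b ∉ A, φ b ∈ A → w b ≠ 0 → ∀ (k : ℕ) (x : EllTwo X), ∃ u : ℕ → ℕ, Tendsto u atTop atTop ∧
    Tendsto (fun j => pairingResidual T E (u j) x (basisVec (φ^[k] (φ b)))) atTop (𝓝 0)

/-- The Cauchy pairing with `U_x`, being bounded on `ℓ²(X)`, is the inner product with `x` because
both agree on all vectors `T'^k e` and `T*^k e`, `e ∈ E`. -/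
theorem IsTrunk.pairing_eq_inner (h : IsTrunk φ T A E) (hT : IsWeightedComposition φ w T)
    (hL : IsLeftInvertible T) (hR : ResidualsVanish φ w T A E)
    (hspan : jointSpan (T†) (cauchyDual T) E = ⊤) {x : EllTwo X} {ψ : EllTwo X →L[ℂ] ℂ}
    (hψ : ∀ y, HasSum (fun n => inner ℂ (laurentCoeff T ((cauchyDual T)†) E n x)
      (laurentCoeff (cauchyDual T) (T†) E n y)) (ψ y)) (y : EllTwo X) :
    ψ y = inner ℂ x y := by
  set K : Submodule ℂ (EllTwo X) := LinearMap.eqLocus ψ.toLinearMap (innerSL ℂ x).toLinearMap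
  have hKc : IsClosed (K : Set (EllTwo X)) := isClosed_eq ψ.continuous (innerSL ℂ x).continuous
  have hK : ∀ z, z ∈ K ↔ ψ z = inner ℂ x z := fun z => Iff.rfl
  have hA : ∀ k : ℕ, ∀ e ∈ E, (cauchyDual T ^ k) e ∈ K := fun k e he =>
    (hK _).2 ((hψ _).unique (hasSum_pairing_cauchyDual_pow hL (h.isWandering hT)
      (h.isWandering_cauchyDual hT hL) x k he))
  have hB : ∀ k : ℕ, E ≤ K.comap ((T†) ^ (k + 1)).toLinearMap := by
    intro k
    refine h.le_of_isClosed (hKc.preimage ((T†) ^ (k + 1)).continuous) ?_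
    intro g _ b hb hb' α hα
    change ((T†) ^ (k + 1)) g ∈ K
    rw [pow_succ, mul_apply_eq_comp, hα, hT.adjoint_basisVec, map_smul, map_smul]
    refine K.smul_mem _ ?_
    -- If `w b = 0`, then `T* e_b = 0` and there is nothing to show.
    by_cases hw : w b = 0
    · rw [hw, map_zero, zero_smul]
      exact K.zero_mem
    refine K.smul_mem _ ?_
    obtain ⟨c, hc⟩ := hT.adjoint_pow_basisVec k (φ b)
    rw [hc]
    refine K.smul_mem _ ((hK _).2 ?_)
    obtain ⟨u, hu, hru⟩ := hR b hb hb' hw k x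
    refine pairing_eq_of_tendsto_residual (hψ _) (fun n => ?_) hu hru
    obtain ⟨d, hd⟩ := hT.adjoint_pow_basisVec n (φ^[k] (φ b))
    rw [hd]
    exact Submodule.smul_mem _ _ (h.mem_orthogonal
      (basisVec_mem_supportedOn (h.mapsTo.iterate n (h.mapsTo.iterate k hb'))))
  have hle : jointSpan (T†) (cauchyDual T) E ≤ K := by
    refine Submodule.topologicalClosure_minimal _ (Submodule.span_le.2 ?_) hKc
    rintro z (⟨n, e, he, rfl⟩ | ⟨n, e, he, rfl⟩)
    · cases n with
      | zero => simpa using hA 0 e he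
      | succ n => exact hB n he
    · exact hA n e he
  rw [hspan] at hle
  exact (hK y).1 (hle trivial)

end Trunk

/-! ### Residuals along a cycle -/

section Cycle

theorem prod_range_le_of_le_one {a : ℕ → ℝ} (h0 : ∀ n, 0 ≤ a n) (h1 : ∀ n, a n ≤ 1) (m k : ℕ) :
    ∏ i ∈ Finset.range (m + k), a i ≤ ∏ i ∈ Finset.range m, a i := by
  rw [Finset.prod_range_add]
  exact mul_le_of_le_one_right (Finset.prod_nonneg fun _ _ => h0 _)
    (Finset.prod_le_one (fun _ _ => h0 _) fun _ _ => h1 _)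

theorem prod_range_mul_le_pow {a : ℕ → ℝ} (h0 : ∀ n, 0 ≤ a n) (h1 : ∀ n, a n ≤ 1) {l : ℕ} {q : ℝ}
    (hq : ∀ j, a (j * (l + 1) + l) = q) (j : ℕ) :
    ∏ i ∈ Finset.range (j * (l + 1)), a i ≤ q ^ j := by
  induction j with
  | zero => simp
  | succ j ih =>
    have hq0 : 0 ≤ q := hq 0 ▸ h0 _
    rw [show (j + 1) * (l + 1) = j * (l + 1) + l + 1 by ring, Finset.prod_range_succ, hq, pow_succ]
    exact mul_le_mul_of_nonneg_right ((prod_range_le_of_le_one h0 h1 _ _).trans ih) hq0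

variable {X : Type*} {φ : X → X} {w : X → ℂ} {T : EllTwo X →L[ℂ] EllTwo X} {A : Set X}
  {E : Submodule ℂ (EllTwo X)} [E.HasOrthogonalProjection]

/-- If the trunk consists of periodic points, then each turn around the cycle multiplies the
residual by the product of the mass ratios, which is less than one as soon as a nonzero
weight leads into the cycle from outside. -/
theorem IsTrunk.residualsVanish_of_subset_periodicPts (h : IsTrunk φ T A E)
    (hT : IsWeightedComposition φ w T) (hL : IsLeftInvertible T) (hA : A ⊆ periodicPts φ) :
    ResidualsVanish φ w T A E := by
  intro b hb hb' hw k x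
  obtain ⟨l, hl, hper⟩ := hA hb'
  obtain ⟨l, rfl⟩ := Nat.exists_eq_add_of_lt hl
  rw [zero_add] at hper
  have hit : ∀ j i : ℕ, φ^[j * (l + 1) + i] (φ b) = φ^[i] (φ b) := by
    intro j i
    rw [add_comm, iterate_add_apply, (hper.const_mul j).eq]
  set z := φ b with hz
  -- `φ^[l] z` is the preimage of `z` on the cycle; it competes with `b` for the mass of `T e_z`.
  set q := massRatio φ w T (φ^[l] z) with hq
  have hq0 : 0 ≤ q := massRatio_nonneg _
  have hq1 : q < 1 := by
    refine massRatio_lt_one hT (b := b) ?_ ?_ hw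
    · intro hbe
      exact hb (hbe ▸ h.mapsTo.iterate l hb')
    · rw [← iterate_succ_apply' φ l z, hper.eq]
  refine ⟨fun j => j * (l + 1) + k, ?_, ?_⟩
  · refine tendsto_atTop_mono (fun j => ?_) tendsto_id
    simp only [id]
    nlinarith [Nat.zero_le (j * l), Nat.zero_le k]
  · have h1 : ∀ j : ℕ, pairingResidual T E (j * (l + 1) + k) x (basisVec (φ^[k] z)) =
        (∏ i ∈ Finset.range (j * (l + 1) + k), massRatio φ w T (φ^[i] z) : ℝ) *
          (starRingEnd ℂ) (x (φ^[k] z)) := by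
      intro j
      have := h.pairingResidual_eq hT hL hb' (j * (l + 1) + k) x
      rwa [hit] at this
    simp only [h1]
    have h2 : Tendsto (fun j : ℕ => ∏ i ∈ Finset.range (j * (l + 1) + k),
        massRatio φ w T (φ^[i] z)) atTop (𝓝 0) := by
      refine squeeze_zero (fun j => Finset.prod_nonneg fun _ _ => massRatio_nonneg _) (fun j => ?_)
        (tendsto_pow_atTop_nhds_zero_of_lt_one hq0 hq1)
      refine (prod_range_le_of_le_one (fun _ => massRatio_nonneg _)
        (fun _ => massRatio_le_one hT _) _ _).trans ?_
      refine prod_range_mul_le_pow (fun _ => massRatio_nonneg _)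
        (fun _ => massRatio_le_one hT _) (fun i => ?_) j
      rw [hit]
    have h3 := ((Complex.continuous_ofReal.tendsto 0).comp h2).mul_const
      ((starRingEnd ℂ) (x (φ^[k] z)))
    simpa using h3

end Cycle

/-! ### The trunk of a map with a cycle -/

section CyclicCase

variable {X : Type*} {φ : X → X} {w : X → ℂ} {T : EllTwo X →L[ℂ] EllTwo X}

theorem mapsTo_periodicPts (φ : X → X) : Set.MapsTo φ (periodicPts φ) (periodicPts φ) :=
  (bijOn_periodicPts φ).mapsTo

theorem generation_eq_zero_iff (hφ : SingleOrbit φ) (hc : HasCycle φ) (xs x : X) :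
    generation φ xs x = 0 ↔ x ∈ periodicPts φ := by
  classical
  refine ⟨fun hx => ?_, generation_of_mem_periodicPts φ xs x⟩
  obtain ⟨p, hp⟩ := hc
  obtain ⟨i, j, hij⟩ := hφ x p
  have h : ∃ n : ℕ, φ^[n] x ∈ periodicPts φ :=
    ⟨i, hij ▸ (mapsTo_periodicPts φ).iterate j hp⟩
  rw [generation, dif_pos h] at hx
  exact (Nat.find_eq_zero h).1 (by exact_mod_cast hx)

theorem generation_eq_one_iff (hφ : SingleOrbit φ) (hc : HasCycle φ) (xs x : X) :
    generation φ xs x = 1 ↔ x ∉ periodicPts φ ∧ φ x ∈ periodicPts φ := by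
  constructor
  · intro hx
    have h1 : x ∉ periodicPts φ := by
      rw [← generation_eq_zero_iff hφ hc xs, hx]
      exact one_ne_zero
    refine ⟨h1, ?_⟩
    rw [← generation_eq_zero_iff hφ hc xs, generation_map φ hφ xs x h1, hx, sub_self]
  · rintro ⟨h1, h2⟩
    rw [← generation_eq_zero_iff hφ hc xs, generation_map φ hφ xs x h1] at h2
    linarith

theorem kerAdjointRestrict_spec (hT : IsWeightedComposition φ w T) {x : X} {g : EllTwo X}
    (hg : g ∈ kerAdjointRestrict hT x) :
    g ∈ supportedOn (descendants φ x) ∧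
      ∀ u ∈ descendants φ x, inner ℂ (T (basisVec u)) g = 0 := by
  obtain ⟨g', hg', rfl⟩ := hg
  refine ⟨g'.2, fun u hu => ?_⟩
  have h1 : ((T.restrict (hT.mapsTo_descendants x))†) g' = 0 := hg'
  have h2 := ContinuousLinearMap.adjoint_inner_right (T.restrict (hT.mapsTo_descendants x))
    ⟨basisVec u, basisVec_mem_supportedOn hu⟩ g'
  rw [h1, inner_zero_right] at h2
  exact h2.symm

/-- A vector of `𝓝((C_{φ,w}|_{ℓ²(Des(x))})^*)` can only fail to be in the kernel of `T*`
because `T e_{φ x}` may have mass at `x`. -/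
theorem adjoint_eq_smul_of_mem_kerAdjointRestrict (hT : IsWeightedComposition φ w T) {x : X}
    (hx : φ x ∉ descendants φ x) {g : EllTwo X} (hg : g ∈ kerAdjointRestrict hT x) :
    (T†) g = g x • (T†) (basisVec x) := by
  obtain ⟨hg1, hg2⟩ := kerAdjointRestrict_spec hT hg
  rw [← map_smul]
  ext u
  rw [adjoint_apply_eq_inner, adjoint_apply_eq_inner, ← sub_eq_zero, ← inner_sub_right]
  by_cases hu : u ∈ descendants φ x
  · have hxu : φ x ≠ u := fun h => hx (h ▸ hu)
    rw [inner_sub_right, hg2 u hu, inner_smul_right, inner_basisVec_right,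
      hT.apply_basisVec_of_ne hxu, map_zero, mul_zero, sub_zero]
  · refine inner_eq_zero_of_forall fun y => ?_
    rw [lp.coeFn_sub, Pi.sub_apply, lp.coeFn_smul, Pi.smul_apply, smul_eq_mul]
    rcases eq_or_ne y x with rfl | hyx
    · right
      rw [basisVec_apply_self, mul_one, sub_self]
    · rw [basisVec_apply_of_ne hyx, mul_zero, sub_zero]
      by_cases hy : y ∈ descendants φ x
      · left
        refine hT.apply_basisVec_of_ne ?_
        rintro rfl
        obtain ⟨n, hn⟩ := hy
        cases n with
        | zero => exact hyx hn
        | succ n => exact hu ⟨n, hn⟩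
      · exact Or.inr (hg1 y hy)

theorem isTrunk_periodicPts (hφ : SingleOrbit φ) (hc : HasCycle φ)
    (hT : IsWeightedComposition φ w T) (Ω : X) :
    IsTrunk φ T (periodicPts φ) (wanderingSubspace hT Ω) where
  mapsTo := mapsTo_periodicPts φ
  injOn := (bijOn_periodicPts φ).injOn
  basisVec_mem := by
    intro b hb hb'
    rw [wanderingSubspace, if_pos hc]
    refine Submodule.le_topologicalClosure _ ?_
    refine Submodule.mem_iSup_of_mem b (Submodule.mem_iSup_of_mem
      ((generation_eq_one_iff hφ hc _ b).2 ⟨hb, hb'⟩) ?_)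
    exact Submodule.mem_sup_left (Submodule.mem_span_singleton_self _)
  le_closure := by
    rw [wanderingSubspace, if_pos hc]
    refine Submodule.topologicalClosure_mono (iSup₂_le fun x hx => ?_)
    obtain ⟨hx1, hx2⟩ := (generation_eq_one_iff hφ hc _ x).1 hx
    have hdes : descendants φ x ⊆ (periodicPts φ)ᶜ := by
      rintro y ⟨n, rfl⟩ hy
      exact hx1 ((mapsTo_periodicPts φ).iterate n hy)
    refine sup_le (Submodule.span_le.2 ?_) fun g hg => ?_
    · rintro _ rfl
      exact Submodule.subset_span
        ⟨basisVec_mem_supportedOn hx1, x, hx1, hx2, 1, (one_smul _ _).symm⟩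
    · refine Submodule.subset_span ⟨fun y hy => ?_, x, hx1, hx2, g x, ?_⟩
      · exact (kerAdjointRestrict_spec hT hg).1 y fun h => hy (hdes h)
      · exact adjoint_eq_smul_of_mem_kerAdjointRestrict hT (fun h => hdes h hx2) hg
  isClosed := Submodule.isClosed_topologicalClosure _

end CyclicCase

/-! ### The trunk of a map without a cycle -/

section RootedCase

variable {X : Type*} {φ : X → X} {w : X → ℂ} {T : EllTwo X →L[ℂ] EllTwo X}

/-- The strict ancestors `φ^[n] Ω`, `n ≥ 1`, of `Ω`. -/
def strictAncestors (φ : X → X) (Ω : X) : Set X :=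
  {c | ∃ n : ℕ, φ^[n + 1] Ω = c}

theorem IsGeneralizedRoot.eq_iterate {Ω : X} (hΩ : IsGeneralizedRoot φ Ω) {n : ℕ} {x : X}
    (hx : φ x = φ^[n + 1] Ω) : x = φ^[n] Ω := by
  obtain ⟨a, ha⟩ := Set.encard_eq_one.1 (hΩ.1 (n + 1) (by omega))
  have h1 : x ∈ φ ⁻¹' {φ^[n + 1] Ω} := hx
  have h2 : φ^[n] Ω ∈ φ ⁻¹' {φ^[n + 1] Ω} := (iterate_succ_apply' φ n Ω).symm
  rw [ha] at h1 h2
  rw [h1, h2]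

theorem not_mem_strictAncestors (hc : ¬ HasCycle φ) (Ω : X) : Ω ∉ strictAncestors φ Ω := by
  rintro ⟨n, hn⟩
  exact hc ⟨Ω, mk_mem_periodicPts n.succ_pos hn⟩

theorem mapsTo_strictAncestors (Ω : X) :
    Set.MapsTo φ (strictAncestors φ Ω) (strictAncestors φ Ω) := by
  rintro _ ⟨n, rfl⟩
  exact ⟨n + 1, iterate_succ_apply' φ _ Ω⟩

theorem IsGeneralizedRoot.eq_of_map_mem {Ω : X} (hΩ : IsGeneralizedRoot φ Ω) {b : X}
    (hb : b ∉ strictAncestors φ Ω) (hb' : φ b ∈ strictAncestors φ Ω) : b = Ω := by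
  obtain ⟨n, hn⟩ := hb'
  have h := hΩ.eq_iterate hn.symm
  cases n with
  | zero => exact h
  | succ n => exact absurd ⟨n, h.symm⟩ hb

theorem isTrunk_strictAncestors (hc : ¬ HasCycle φ) (hT : IsWeightedComposition φ w T)
    (hL : IsLeftInvertible T) {Ω : X} (hΩ : IsGeneralizedRoot φ Ω) :
    IsTrunk φ T (strictAncestors φ Ω) (wanderingSubspace hT Ω) where
  mapsTo := mapsTo_strictAncestors Ω
  injOn := by
    rintro u - _ ⟨n, rfl⟩ h
    rw [← iterate_succ_apply' φ] at h
    exact hΩ.eq_iterate h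
  basisVec_mem := by
    intro b hb hb'
    rw [wanderingSubspace, if_neg hc, hΩ.eq_of_map_mem hb hb']
    exact Submodule.le_topologicalClosure _
      (Submodule.mem_sup_left (Submodule.mem_span_singleton_self _))
  le_closure := by
    rw [wanderingSubspace, if_neg hc]
    have h1 : Ω ∉ strictAncestors φ Ω := not_mem_strictAncestors hc Ω
    have h2 : φ Ω ∈ strictAncestors φ Ω := ⟨0, rfl⟩
    refine Submodule.topologicalClosure_mono (sup_le (Submodule.span_le.2 ?_) fun g hg => ?_)
    · rintro _ rfl
      exact Submodule.subset_span
        ⟨basisVec_mem_supportedOn h1, Ω, h1, h2, 1, (one_smul _ _).symm⟩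
    · have hg0 : (T†) g = 0 := hg
      refine Submodule.subset_span ⟨fun x hx => ?_, Ω, h1, h2, 0, by rw [hg0, zero_smul]⟩
      obtain ⟨n, rfl⟩ := not_not.1 hx
      set v := φ^[n + 1] Ω with hv
      -- `v` is the only preimage of `φ v`, so `T e_{φ v}` is a nonzero multiple of `e_v`.
      have h3 : T (basisVec (φ v)) = w v • basisVec v := by
        ext x
        rw [lp.coeFn_smul, Pi.smul_apply, smul_eq_mul]
        rcases eq_or_ne x v with rfl | hxv
        · rw [hT.apply_basisVec_map, basisVec_apply_self, mul_one]
        · rw [basisVec_apply_of_ne hxv, mul_zero]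
          refine hT.apply_basisVec_of_ne fun h => hxv ?_
          rw [hv, ← iterate_succ_apply' φ] at h
          exact hΩ.eq_iterate h
      have hw : w v ≠ 0 := by
        intro h
        rw [h, zero_smul] at h3
        exact hL.apply_basisVec_ne_zero _ h3
      have h4 := adjoint_apply_eq_inner T g (φ v)
      rw [hg0, h3, inner_smul_left, inner_basisVec_left] at h4
      exact (mul_eq_zero.1 h4.symm).resolve_left (by simpa using hw)
  isClosed := Submodule.isClosed_topologicalClosure _

/-- The expansion of `e_c` for the strict ancestor `c = φ^[k + 1] Ω` is finite: after `k` steps it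
has reached `φ Ω`, which has no preimage in the trunk. -/
theorem residualsVanish_strictAncestors (hc : ¬ HasCycle φ) (hT : IsWeightedComposition φ w T)
    (hL : IsLeftInvertible T) {Ω : X} (hΩ : IsGeneralizedRoot φ Ω) :
    ResidualsVanish φ w T (strictAncestors φ Ω) (wanderingSubspace hT Ω) := by
  intro b hb hb' _ k x
  have h := isTrunk_strictAncestors hc hT hL hΩ
  rw [hΩ.eq_of_map_mem hb hb']
  have h2 : φ Ω ∈ strictAncestors φ Ω := ⟨0, rfl⟩
  have hmem : cauchyDual T (basisVec (φ Ω)) ∈ wanderingSubspace hT Ω := by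
    refine h.cauchyDual_basisVec_mem hT hL h2 fun v hv hvΩ => ?_
    rw [show v = Ω from hΩ.eq_iterate (n := 0) hvΩ] at hv
    exact not_mem_strictAncestors hc Ω hv
  refine ⟨fun j => k + (j + 1), ?_, ?_⟩
  · exact tendsto_atTop_mono (fun j => by simp only [id]; omega) tendsto_id
  · refine tendsto_const_nhds.congr fun j => ?_
    rw [h.pairingResidual_iterate hT hL h2, pairingResidual_succ hL
      (h.isWandering_cauchyDual hT hL) j _ (v := 0) (β := 0) (Submodule.zero_mem _)
      (by simpa using hmem), zero_mul, mul_zero]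

end RootedCase

/-! ### The duality -/

theorem exists_isTrunk {X : Type*} {φ : X → X} {w : X → ℂ} (hφ : SingleOrbit φ) {Ω : X}
    (hΩ : ¬ HasCycle φ → IsGeneralizedRoot φ Ω) {T : EllTwo X →L[ℂ] EllTwo X}
    (hT : IsWeightedComposition φ w T) (hL : IsLeftInvertible T) :
    ∃ A : Set X, IsTrunk φ T A (wanderingSubspace hT Ω) ∧
      ResidualsVanish φ w T A (wanderingSubspace hT Ω) := by
  by_cases hc : HasCycle φ
  · have h := isTrunk_periodicPts hφ hc hT Ω
    exact ⟨_, h, h.residualsVanish_of_subset_periodicPts hT hL subset_rfl⟩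
  · exact ⟨_, isTrunk_strictAncestors hc hT hL (hΩ hc),
      residualsVanish_strictAncestors hc hT hL (hΩ hc)⟩

end

/-- Mathlib's inner product is conjugate-linear in its first argument, so the pairing `⟨a, b⟩`
that is linear in `a` is `inner ℂ b a`. -/
theorem theorem7p3 {X : Type*} [Countable X] (φ : X → X) (w : X → ℂ)
    (hφ : SingleOrbit φ)
    (Ω : X) (hΩ : ¬ HasCycle φ → IsGeneralizedRoot φ Ω)
    (hfin : FiniteBranchingIndex φ (φ Ω))
    (T : EllTwo X →L[ℂ] EllTwo X) (hT : IsWeightedComposition φ w T)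
    (rm rp rm' rp' : ℝ≥0∞)
    (h : DualConvergence T (wanderingSubspace hT Ω) rm rp rm' rp')
    (hrm : rm < 1) (hrm' : rm' ≤ 1) (hrp' : 1 ≤ rp')
    (f : modelSpace T (wanderingSubspace hT Ω))
    (hf : ExtendsToInfinity rm rp (f : ℤ → wanderingSubspace hT Ω))
    (g : dualModelSpace T (wanderingSubspace hT Ω)) :
    HasSum
      (fun n : ℤ => inner ℂ ((g : ℤ → wanderingSubspace hT Ω) n)
        ((f : ℤ → wanderingSubspace hT Ω) n))
      (inner ℂ ((dualModelEquiv T (wanderingSubspace hT Ω) h.dual_span_eq_top).symm g)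
        ((modelEquiv T (wanderingSubspace hT Ω) h.span_eq_top).symm f)) := by
  obtain ⟨x, rfl⟩ := (modelEquiv T (wanderingSubspace hT Ω) h.span_eq_top).surjective f
  obtain ⟨y, rfl⟩ := (dualModelEquiv T (wanderingSubspace hT Ω) h.dual_span_eq_top).surjective g
  rw [LinearEquiv.symm_apply_apply, LinearEquiv.symm_apply_apply]
  have hx : ((modelEquiv T (wanderingSubspace hT Ω) h.span_eq_top x :
      modelSpace T (wanderingSubspace hT Ω)) : ℤ → wanderingSubspace hT Ω) =
      fun n => laurentCoeff T ((cauchyDual T)†) (wanderingSubspace hT Ω) n x :=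
    funext fun n => laurentMap_apply _ _ _ x n
  have hy : ((dualModelEquiv T (wanderingSubspace hT Ω) h.dual_span_eq_top y :
      dualModelSpace T (wanderingSubspace hT Ω)) : ℤ → wanderingSubspace hT Ω) =
      fun n => laurentCoeff (cauchyDual T) (T†) (wanderingSubspace hT Ω) n y :=
    funext fun n => laurentMap_apply _ _ _ y n
  rw [hx] at hf
  rw [hx, hy]
  have hsum : ∀ z, Summable fun n =>
      inner ℂ (laurentCoeff T ((cauchyDual T)†) (wanderingSubspace hT Ω) n x)
        (laurentCoeff (cauchyDual T) (T†) (wanderingSubspace hT Ω) n z) := by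
    intro z
    have hz := h.dual_converges _ (LinearMap.mem_range_self _ z)
    rw [show laurentMap (cauchyDual T) (T†) (wanderingSubspace hT Ω) z = fun n =>
      laurentCoeff (cauchyDual T) (T†) (wanderingSubspace hT Ω) n z from
      funext fun n => laurentMap_apply _ _ _ z n] at hz
    exact Summable.of_norm_bounded
      (hf.summable_norm_mul_norm h.radius_lt h.dual_radius_lt hrm hrm' hz)
      fun n => norm_inner_le_norm _ _
  obtain ⟨ψ, hψ⟩ := exists_hasSum_pairing _ _ _ _ hsum
  obtain ⟨A, hA, hR⟩ := exists_isTrunk hφ hΩ hT h.leftInvertible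
  have hxy := hψ y
  rw [hA.pairing_eq_inner hT h.leftInvertible hR h.span_eq_top hψ y] at hxy
  simpa only [RCLike.star_def, inner_conj_symm] using hxy.star
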